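/- Let $n\ge 2$ and $\alpha\in\left(\frac1n,\,1+\frac1n\right)$. Let $M^n$ be a closed smooth $n$-manifold and $F:M^n\to\mathbb{R}^{n+1}$ a smooth immersion whose image $\Sigma=F(M^n)$ is a closed strictly convex hypersurface, i.e. $\Sigma$ is the boundary of a compact convex set with non-empty interior and its second fundamental form $h_{ij}=\langle\partial_i\partial_jF,\vec n\rangle$ with respect to the interior unit normal $\vec n$ is positive definite. Let $g_{ij}=\langle\partial_iF,\partial_jF\rangle$ be the induced metric, $\lambda_1,\dots,\lambda_n>0$ the principal curvatures (the eigenvalues of $g^{-1}h$, with multiplicity) and $K=\lambda_1\cdots\lambda_n$ the Gauss curvature. Assume that $$K^\alpha(p)=-\langle F(p),\vec n(p)\rangle\qquad\text{for all }p\in M^n .$$ If the function $$f(p)=K^\alpha(p)\sum_{i=1}^n\lambda_i^{-1}(p)-\frac{n\alpha-1}{2\alpha}\,|F(p)|^2$$ attains its maximum over $M^n$ at a point $p_0$, then $F(p_0)$ is an umbilical point (that is, $\lambda_1(p_0)=\dots=\lambda_n(p_0)$) and $\nabla|F|^2(p_0)=0$. -/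

import Mathlib

open scoped Manifold ContDiff

noncomputable section

namespace GaussShrinker

/-- A closed convex hypersurface of `ℝⁿ⁺¹`: the boundary of a compact convex set with non-empty
interior. -/
def IsClosedConvexHypersurface {n : ℕ} (S : Set (EuclideanSpace ℝ (Fin (n + 1)))) : Prop :=
  ∃ C : Set (EuclideanSpace ℝ (Fin (n + 1))),
    Convex ℝ C ∧ IsCompact C ∧ (interior C).Nonempty ∧ S = frontier C

/-- The matrix `g_ij = ⟨∂_i X, ∂_j X⟩` of the first fundamental form of a parametrization `X`,
at the parameter value `x`. -/
def firstForm {n : ℕ} (X : EuclideanSpace ℝ (Fin n) → EuclideanSpace ℝ (Fin (n + 1)))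
    (x : EuclideanSpace ℝ (Fin n)) : Matrix (Fin n) (Fin n) ℝ :=
  Matrix.of fun i j =>
    inner ℝ (fderiv ℝ X x (EuclideanSpace.single i 1)) (fderiv ℝ X x (EuclideanSpace.single j 1))

/-- The matrix `h_ij = ⟨∂_i ∂_j X, ν⟩` of the second fundamental form of a parametrization `X`,
at the parameter value `x`, with respect to the normal vector `ν`. -/
def secondForm {n : ℕ} (X : EuclideanSpace ℝ (Fin n) → EuclideanSpace ℝ (Fin (n + 1)))
    (ν : EuclideanSpace ℝ (Fin (n + 1))) (x : EuclideanSpace ℝ (Fin n)) :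
    Matrix (Fin n) (Fin n) ℝ :=
  Matrix.of fun i j =>
    inner ℝ (fderiv ℝ (fderiv ℝ X) x (EuclideanSpace.single i 1) (EuclideanSpace.single j 1)) ν

section Immersion

variable {n : ℕ} {M : Type*} [TopologicalSpace M] [ChartedSpace (EuclideanSpace ℝ (Fin n)) M]

/-- The metric `g_ij` induced by `F : Mⁿ → ℝⁿ⁺¹` at `p`, in the preferred chart at `p`. -/
def metric (F : M → EuclideanSpace ℝ (Fin (n + 1))) (p : M) : Matrix (Fin n) (Fin n) ℝ :=
  firstForm (F ∘ (extChartAt (𝓡 n) p).symm) (extChartAt (𝓡 n) p p)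

/-- The second fundamental form `h_ij` of `F : Mⁿ → ℝⁿ⁺¹` at `p` with respect to the unit normal
`N`, in the preferred chart at `p`. -/
def secondFundamentalForm (F N : M → EuclideanSpace ℝ (Fin (n + 1))) (p : M) :
    Matrix (Fin n) (Fin n) ℝ :=
  secondForm (F ∘ (extChartAt (𝓡 n) p).symm) (N p) (extChartAt (𝓡 n) p p)

/-- The principal curvatures `λ_1, …, λ_n` at `p`, listed with multiplicity: the eigenvalues of the
Weingarten map, whose matrix is `g⁻¹ h`. They do not depend on the chart. -/
def principalCurvatures (F N : M → EuclideanSpace ℝ (Fin (n + 1))) (p : M) : Multiset ℝ :=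
  ((metric F p)⁻¹ * secondFundamentalForm F N p).charpoly.roots

/-- The Gauss curvature: the product of the principal curvatures. -/
def gaussCurvature (F N : M → EuclideanSpace ℝ (Fin (n + 1))) (p : M) : ℝ :=
  (principalCurvatures F N p).prod

/-- `ν` is the interior unit normal at `F p` of the closed convex hypersurface `S`, parametrized
by `F`: it has length one, is orthogonal to the tangent space, and points to the side of the
tangent hyperplane on which `S` lies. -/
def IsInteriorUnitNormal (S : Set (EuclideanSpace ℝ (Fin (n + 1))))
    (F : M → EuclideanSpace ℝ (Fin (n + 1))) (p : M) (ν : EuclideanSpace ℝ (Fin (n + 1))) :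
    Prop :=
  ‖ν‖ = 1 ∧
  (∀ v : TangentSpace (𝓡 n) p, inner ℝ (mvfderiv (𝓡 n) F p v) ν = 0) ∧
  ∀ y ∈ S, 0 ≤ inner ℝ (y - F p) ν

/-- `F p` is an umbilical point: `h_ij = κ g_ij` at `p` for some `κ`, that is, all principal
curvatures at `p` coincide. -/
def IsUmbilical (F N : M → EuclideanSpace ℝ (Fin (n + 1))) (p : M) : Prop :=
  ∃ κ : ℝ, secondFundamentalForm F N p = κ • metric F p

/-- The function `f = K^α ∑ λ_i⁻¹ - (nα - 1)/(2α) |F|²`. -/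
def fFun (α : ℝ) (F N : M → EuclideanSpace ℝ (Fin (n + 1))) (p : M) : ℝ :=
  gaussCurvature F N p ^ α * ((principalCurvatures F N p).map fun l => l⁻¹).sum
    - (n * α - 1) / (2 * α) * ‖F p‖ ^ 2

end Immersion

end GaussShrinker

end

/-! Put γ = 1 - 1/(nα), β = 1/α = n(1 - γ) and w = K^α / λ_min - (γ/2)|F|² (`radiusFun`). Each 1/λ_i
is at most 1/λ_min, so f ≤ n w, with equality at umbilical points. Suppose every maximum point q of
w is umbilical with F(q) normal. Then n w(q) = f(q) ≤ f(p₀) ≤ n w(p₀), so p₀ is itself a maximum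
point of w and has both properties. A point q exists because w is upper semicontinuous
(`upperSemicontinuous_radiusFun`) and the manifold is compact.

To study such a q (`isUmbilical_of_isMax_radiusFun`), write the hypersurface near q as the graph of
φ over its tangent hyperplane. The shrinker equation becomes log det D²φ = β log(y·∇φ - φ) +
(n+2-β)/2 · log(1+|∇φ|²). Since λ_min need not be differentiable, maximality of w is used as a
Rayleigh inequality valid for every direction. Inserting directions e_o + t a, with e_o a direction
of least curvature at q, gives smooth functions of t with a maximum at t = 0
(`umbilic_of_max_of_graph`).

Divide the i-th second-order condition by λ_i and sum. The fourth derivatives are eliminated by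
differentiating the equation twice along e_o, the third derivatives by a good choice of a and the
first-order condition. What remains (`umbilic_of_jet_inequalities`) is Σ_k [γ(1 - λ_o/λ_k) + (λ_o/u)
e_k y_k²] ≤ 0, where u is the support function, y the tangential part of F and all e_k > 0. Every
summand is nonnegative, so all λ_k equal λ_o and y = 0. Positivity of e_k needs β > 1/2, that is α <
2. -/

section ShrinkerMaximumPrinciple

open Filter Topology Matrix

/-! ### Calculus of second-order jets at 0 -/

/-- `f` is twice differentiable at `0`, with value, first and second derivatives `a`, `b`, `c`. -/
def HasJet (f : ℝ → ℝ) (a b c : ℝ) : Prop :=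
  ∃ f' : ℝ → ℝ, (∀ᶠ t in 𝓝 0, HasDerivAt f (f' t) t) ∧ f 0 = a ∧ f' 0 = b ∧ HasDerivAt f' c 0

namespace HasJet

variable {f g : ℝ → ℝ} {a b c a' b' c' : ℝ}

theorem const (a : ℝ) : HasJet (fun _ => a) a 0 0 :=
  ⟨fun _ => 0, .of_forall fun t => hasDerivAt_const t a, rfl, rfl, hasDerivAt_const _ _⟩

theorem id : HasJet (fun t => t) 0 1 0 :=
  ⟨fun _ => 1, .of_forall fun t => hasDerivAt_id t, rfl, rfl, hasDerivAt_const _ _⟩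

theorem add (hf : HasJet f a b c) (hg : HasJet g a' b' c') :
    HasJet (fun t => f t + g t) (a + a') (b + b') (c + c') := by
  obtain ⟨f', h1, h2, h3, h4⟩ := hf
  obtain ⟨g', k1, k2, k3, k4⟩ := hg
  refine ⟨fun t => f' t + g' t, ?_, by simp only [h2, k2], by simp only [h3, k3], h4.add k4⟩
  filter_upwards [h1, k1] with t h k using h.add k

theorem mul (hf : HasJet f a b c) (hg : HasJet g a' b' c') :
    HasJet (fun t => f t * g t) (a * a') (b * a' + a * b') (c * a' + 2 * b * b' + a * c') := by
  obtain ⟨f', h1, h2, h3, h4⟩ := hf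
  obtain ⟨g', k1, k2, k3, k4⟩ := hg
  refine ⟨fun t => f' t * g t + f t * g' t, ?_, by simp only [h2, k2], by simp only [h2, h3, k2, k3], ?_⟩
  · filter_upwards [h1, k1] with t h k using h.mul k
  · refine ((h4.mul k1.self_of_nhds).add (h1.self_of_nhds.mul k4)).congr_deriv ?_
    rw [h2, h3, k2, k3]; ring

theorem const_mul (r : ℝ) (hf : HasJet f a b c) :
    HasJet (fun t => r * f t) (r * a) (r * b) (r * c) := by
  convert (const r).mul hf using 1 <;> ring

theorem sub (hf : HasJet f a b c) (hg : HasJet g a' b' c') :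
    HasJet (fun t => f t - g t) (a - a') (b - b') (c - c') := by
  convert hf.add (hg.const_mul (-1)) using 1
  · ext; ring
  all_goals ring

theorem sum {ι : Type*} (s : Finset ι) {f : ι → ℝ → ℝ} {a b c : ι → ℝ}
    (h : ∀ i ∈ s, HasJet (f i) (a i) (b i) (c i)) :
    HasJet (fun t => ∑ i ∈ s, f i t) (∑ i ∈ s, a i) (∑ i ∈ s, b i) (∑ i ∈ s, c i) := by
  classical
  induction s using Finset.induction_on with
  | empty => simpa using const 0
  | insert i s hi ih =>
    simp only [Finset.sum_insert hi]
    exact (h i (by simp)).add (ih fun j hj => h j (by simp [hj]))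

theorem log (hf : HasJet f a b c) (ha : 0 < a) :
    HasJet (fun t => Real.log (f t)) (Real.log a) (b / a) (c / a - b ^ 2 / a ^ 2) := by
  obtain ⟨f', h1, h2, h3, h4⟩ := hf
  have hc : ∀ᶠ t in 𝓝 (0 : ℝ), 0 < f t :=
    h1.self_of_nhds.continuousAt.eventually (lt_mem_nhds (by rwa [h2]))
  refine ⟨fun t => f' t / f t, ?_, by simp only [h2], by simp only [h2, h3], ?_⟩
  · filter_upwards [h1, hc] with t h k using h.log k.ne'
  · refine (h4.div h1.self_of_nhds hc.self_of_nhds.ne').congr_deriv ?_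
    rw [h2, h3]; field_simp

theorem congr (hf : HasJet f a b c) (h : f =ᶠ[𝓝 0] g) : HasJet g a b c := by
  obtain ⟨f', h1, h2, h3, h4⟩ := hf
  refine ⟨f', ?_, by rw [← h2]; exact h.self_of_nhds.symm, h3, h4⟩
  filter_upwards [h1, h.eventuallyEq_nhds] with t h k
  exact h.congr_of_eventuallyEq k.symm

theorem unique (hf : HasJet f a b c) (hg : HasJet f a' b' c') : b = b' ∧ c = c' := by
  obtain ⟨f', h1, h2, h3, h4⟩ := hf
  obtain ⟨g', k1, k2, k3, k4⟩ := hg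
  have e : f' =ᶠ[𝓝 0] g' := by filter_upwards [h1, k1] with t h k using h.unique k
  exact ⟨by rw [← h3, ← k3]; exact e.self_of_nhds, (h4.congr_of_eventuallyEq e.symm).unique k4⟩

/-- The necessary first and second order conditions at a local maximum. -/
theorem of_isLocalMax (hf : HasJet f a b c) (h : IsLocalMax f 0) : b = 0 ∧ c ≤ 0 := by
  obtain ⟨f', h1, h2, h3, h4⟩ := hf
  have hb : f' 0 = 0 := h.hasDerivAt_eq_zero h1.self_of_nhds
  refine ⟨h3 ▸ hb, ?_⟩
  by_contra! hc
  -- With f'(0) = 0 and f''(0) > 0, the derivative is positive just to the right of 0, so f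
  -- increases there strictly, against maximality.
  have h5 : ∀ᶠ t in 𝓝[≠] (0 : ℝ), 0 < slope f' 0 t :=
    (hasDerivAt_iff_tendsto_slope.1 h4).eventually (lt_mem_nhds hc)
  rw [eventually_nhdsWithin_iff] at h5
  obtain ⟨ε, hε, hh⟩ := Metric.eventually_nhds_iff.1 (h1.and (h5.and h))
  have key : StrictMonoOn f (Set.Icc 0 (ε / 2)) := by
    refine strictMonoOn_of_deriv_pos (convex_Icc _ _) ?_ ?_
    · intro t ht
      refine (hh ?_).1.continuousAt.continuousWithinAt
      rw [Real.dist_eq, sub_zero, abs_of_nonneg ht.1]; linarith [ht.2]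
    · intro t ht
      rw [interior_Icc] at ht
      have := hh (y := t) (by rw [Real.dist_eq, sub_zero, abs_of_pos ht.1]; linarith [ht.2])
      rw [this.1.deriv]
      have h6 := this.2.1 ht.1.ne'
      rw [slope_def_field, hb, sub_zero, sub_zero] at h6
      exact (div_pos_iff_of_pos_right ht.1).1 h6
  have h7 := key (Set.left_mem_Icc.2 (by linarith)) (Set.right_mem_Icc.2 (by linarith))
    (half_pos hε)
  have h8 := (hh (y := ε / 2)
    (by rw [Real.dist_eq, sub_zero, abs_of_pos (half_pos hε)]; linarith)).2.2
  linarith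

end HasJet

/-! ### Derivatives of log det -/

section LogDet

variable {n : ℕ}

/-- Jacobi's formula for the derivative of a determinant. -/
theorem hasDerivAt_det {A : ℝ → Matrix (Fin n) (Fin n) ℝ} {A' : Matrix (Fin n) (Fin n) ℝ} {t : ℝ}
    (h : ∀ i j, HasDerivAt (fun s => A s i j) (A' i j) t) :
    HasDerivAt (fun s => (A s).det) (∑ i, ∑ j, A' i j * (A t).adjugate j i) t := by
  have h1 : HasDerivAt (fun s => (A s).det)
      (∑ σ : Equiv.Perm (Fin n), ((Equiv.Perm.sign σ : ℤ) : ℝ) *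
        ∑ i, (∏ j ∈ Finset.univ.erase i, A t (σ j) j) * A' (σ i) i) t := by
    simp only [Matrix.det_apply']
    refine HasDerivAt.fun_sum fun σ _ => HasDerivAt.const_mul _ ?_
    simpa using HasDerivAt.fun_finsetProd (u := Finset.univ)
      (f := fun i s => A s (σ i) i) (f' := fun i => A' (σ i) i) fun i _ => h (σ i) i
  convert h1 using 1
  -- Cramer's rule: pairing a column with the cofactors of column i gives the determinant with that
  -- column inserted.
  have h2 : ∀ i : Fin n, ∑ j, A' j i * (A t).adjugate i j = ((A t).updateCol i fun j => A' j i).det := by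
    intro i
    rw [← Matrix.cramer_apply, Matrix.cramer_eq_adjugate_mulVec]
    simp [Matrix.mulVec, dotProduct, mul_comm]
  rw [Finset.sum_comm]
  simp_rw [h2, Matrix.det_apply', Finset.mul_sum]
  rw [Finset.sum_comm]
  refine Finset.sum_congr rfl fun σ _ => Finset.sum_congr rfl fun i _ => ?_
  congr 1
  rw [← Finset.mul_prod_erase _ _ (Finset.mem_univ i), mul_comm]
  congr 1
  · refine Finset.prod_congr rfl fun j hj => ?_
    rw [Matrix.updateCol_ne (Finset.ne_of_mem_erase hj)]
  · simp

/-- The first derivative of log det A is tr(A⁻¹A'). Differentiating it again with (A⁻¹)' = -A⁻¹A'A⁻¹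
gives the second; the diagonal value at 0 makes all terms explicit. -/
theorem hasJet_log_det {A : Fin n → Fin n → ℝ → ℝ} {l : Fin n → ℝ} (hl : ∀ i, 0 < l i)
    {B C : Fin n → Fin n → ℝ}
    (h : ∀ i j, HasJet (A i j) (if i = j then l i else 0) (B i j) (C i j)) :
    HasJet (fun t => Real.log (Matrix.of fun i j => A i j t).det) (Real.log (∏ i, l i))
      (∑ i, B i i / l i) (∑ i, C i i / l i - ∑ i, ∑ j, B i j * B j i / (l i * l j)) := by
  choose A' h1 h2 h3 h4 using h
  set M : ℝ → Matrix (Fin n) (Fin n) ℝ := fun t => Matrix.of fun i j => A i j t with hM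
  have hM0 : M 0 = Matrix.diagonal l := by
    ext i j; simp [hM, h2, Matrix.diagonal_apply]
  have hd0 : (M 0).det = ∏ i, l i := by rw [hM0, Matrix.det_diagonal]
  have hpos : 0 < ∏ i, l i := Finset.prod_pos fun i _ => hl i
  have hA : ∀ᶠ t in 𝓝 (0 : ℝ), ∀ i j, HasDerivAt (A i j) (A' i j t) t :=
    eventually_all.2 fun i => eventually_all.2 fun j => h1 i j
  have hdet : ∀ᶠ t in 𝓝 (0 : ℝ), HasDerivAt (fun s => (M s).det)
      (∑ i, ∑ j, A' i j t * (M t).adjugate j i) t := by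
    filter_upwards [hA] with t ht
    exact hasDerivAt_det (A := M) (A' := Matrix.of fun i j => A' i j t) ht
  have hne : ∀ᶠ t in 𝓝 (0 : ℝ), 0 < (M t).det :=
    hdet.self_of_nhds.continuousAt.eventually (lt_mem_nhds (by simpa only [hd0] using hpos))
  have hadj : ∀ i j, DifferentiableAt ℝ (fun t => (M t).adjugate i j) 0 := by
    intro i j
    simp only [Matrix.adjugate_apply]
    -- An adjugate entry is the determinant of a matrix whose row j is constant, so row j of the
    -- derivative is zero.
    refine (hasDerivAt_det (A' := Matrix.updateRow (Matrix.of fun i j => A' i j 0) j 0)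
      fun k m => ?_).differentiableAt
    by_cases hk : k = j
    · subst hk; simpa using hasDerivAt_const (0 : ℝ) _
    · simp only [Matrix.updateRow_ne hk]
      exact hA.self_of_nhds k m
  have hinv : ∀ i j, DifferentiableAt ℝ (fun t => (M t)⁻¹ i j) 0 := by
    intro i j
    simp only [Matrix.inv_def, Ring.inverse_eq_inv', Matrix.smul_apply, smul_eq_mul]
    exact (hdet.self_of_nhds.differentiableAt.inv (by rw [hd0]; exact hpos.ne')).mul (hadj i j)
  have hI0 : (M 0)⁻¹ = Matrix.diagonal fun i => (l i)⁻¹ := by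
    rw [hM0]
    refine Matrix.inv_eq_right_inv ?_
    rw [Matrix.diagonal_mul_diagonal]
    simp [(hl _).ne']
  have hI' : ∀ i j, HasDerivAt (fun t => (M t)⁻¹ i j) (-(B i j / (l i * l j))) 0 := by
    intro i j
    -- Differentiate A A⁻¹ = 1 entrywise; at 0 the matrix is diagonal, so the relation can be solved
    -- for the derivative of each entry of A⁻¹.
    have e1 : HasDerivAt (fun t => ∑ k, A i k t * (M t)⁻¹ k j)
        (∑ k, (A' i k 0 * (M 0)⁻¹ k j + A i k 0 * deriv (fun t => (M t)⁻¹ k j) 0)) 0 :=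
      HasDerivAt.fun_sum fun k _ => (hA.self_of_nhds i k).mul (hinv k j).hasDerivAt
    have e2 : (fun t => ∑ k, A i k t * (M t)⁻¹ k j) =ᶠ[𝓝 0] fun _ => (1 : Matrix (Fin n) (Fin n) ℝ) i j := by
      filter_upwards [hne] with t ht
      rw [← Matrix.mul_nonsing_inv (M t) (isUnit_iff_ne_zero.2 ht.ne')]
      rfl
    have e3 := e1.unique ((hasDerivAt_const (0 : ℝ) _).congr_of_eventuallyEq e2)
    simp only [hI0, h2, h3, Matrix.diagonal_apply, Finset.sum_add_distrib, mul_ite, mul_zero,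
      ite_mul, zero_mul, Finset.sum_ite_eq, Finset.sum_ite_eq', Finset.mem_univ, if_true] at e3
    refine (hinv i j).hasDerivAt.congr_deriv ?_
    have := (hl i).ne'; have := (hl j).ne'
    field_simp at e3 ⊢
    linarith
  refine ⟨fun t => ∑ i, ∑ j, A' i j t * (M t)⁻¹ j i, ?_, by rw [← hd0], ?_, ?_⟩
  · filter_upwards [hdet, hne] with t h k
    convert h.log k.ne' using 1
    simp only [Matrix.inv_def, Ring.inverse_eq_inv', Matrix.smul_apply, smul_eq_mul,
      Finset.sum_div]
    refine Finset.sum_congr rfl fun i _ => Finset.sum_congr rfl fun j _ => ?_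
    ring
  · simp [hI0, h3, Matrix.diagonal_apply, div_eq_mul_inv]
  · refine (HasDerivAt.fun_sum (u := Finset.univ) fun i _ => HasDerivAt.fun_sum (u := Finset.univ)
      fun j _ => (h4 i j).mul (hI' j i)).congr_deriv ?_
    simp only [hI0, h3, Matrix.diagonal_apply, Finset.sum_add_distrib, mul_ite, mul_zero,
      Finset.sum_ite_eq', Finset.mem_univ, if_true, mul_neg, Finset.sum_neg_distrib, div_eq_mul_inv,
      sub_eq_add_neg]
    congr 2
    refine Finset.sum_congr rfl fun i _ => Finset.sum_congr rfl fun j _ => ?_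
    ring

end LogDet

/-! ### The algebraic inequality at the maximum point -/

section Algebra

variable {ι : Type*} [Fintype ι] [DecidableEq ι]

/-- The terms quadratic in the third derivatives `X` that survive in the maximum principle. -/
theorem sum_third_derivatives_ge {l : ι → ℝ} (hl : ∀ i, 0 < l i) (o : ι)
    {X : ι → ι → ℝ} (hX : ∀ i k, X i k = X k i) :
    ∑ k, (if k = o then -(X o o ^ 2 / l o ^ 2) else 2 * X o k ^ 2 / l k ^ 2) ≤
      ∑ i, ∑ k, (-(X i k ^ 2 / (l i * l k)) +
        if k = o then 0 else 2 * X i k ^ 2 * (1 / l k + l o / l k ^ 2) / l i) := by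
  -- Entries with both indices different from o are nonnegative and are dropped. By symmetry of X
  -- the remaining (o,k) and (k,o) entries add up to 2 X_ok² / l_k².
  have h1 : ∀ i, (if i = o then
      ∑ k, (-(X o k ^ 2 / (l o * l k)) +
        if k = o then 0 else 2 * X o k ^ 2 * (1 / l k + l o / l k ^ 2) / l o)
      else -(X i o ^ 2 / (l i * l o))) ≤
      ∑ k, (-(X i k ^ 2 / (l i * l k)) +
        if k = o then 0 else 2 * X i k ^ 2 * (1 / l k + l o / l k ^ 2) / l i) := by
    intro i
    by_cases hi : i = o
    · rw [if_pos hi, hi]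
    · rw [if_neg hi, ← Finset.add_sum_erase _ _ (Finset.mem_univ o)]
      simp only [if_true, add_zero]
      refine le_add_of_nonneg_right (Finset.sum_nonneg fun k hk => ?_)
      rw [if_neg (Finset.ne_of_mem_erase hk)]
      have := hl i; have := hl k; have := hl o
      have : -(X i k ^ 2 / (l i * l k)) + 2 * X i k ^ 2 * (1 / l k + l o / l k ^ 2) / l i =
        X i k ^ 2 / (l i * l k) + 2 * X i k ^ 2 * l o / (l k ^ 2 * l i) := by
        field_simp; ring
      rw [this]; positivity
  refine le_trans (le_of_eq ?_) (Finset.sum_le_sum fun i _ => h1 i)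
  rw [← Finset.add_sum_erase _ _ (Finset.mem_univ o), ← Finset.add_sum_erase Finset.univ
    (fun i => if i = o then _ else _) (Finset.mem_univ o), if_pos rfl, if_pos rfl,
    ← Finset.add_sum_erase _ _ (Finset.mem_univ o), if_pos rfl, add_zero, add_assoc,
    ← Finset.sum_add_distrib]
  congr 1
  · congr 2; ring
  · refine Finset.sum_congr rfl fun k hk => ?_
    have := (hl k).ne'; have := (hl o).ne'
    simp only [if_neg (Finset.ne_of_mem_erase hk), hX k o]
    field_simp; ring

/-- The algebra behind the maximum principle: `l` are the eigenvalues of the second fundamental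
form at the maximum point, `l o` is the least one, `y` is the tangential part of the position
vector, `u` the support function, `T` and `Q` the third and fourth derivatives. -/
theorem umbilic_of_jet_inequalities {l : ι → ℝ} (hl : ∀ i, 0 < l i) (o : ι) (ho : ∀ i, l o ≤ l i)
    (hn : 2 ≤ Fintype.card ι) {β γ u : ℝ} (hu : 0 < u) (hγ : 0 < γ) (hγ1 : γ < 1)
    (hβγ : β = Fintype.card ι * (1 - γ)) (hβ : 1 / 2 < β)
    {y : ι → ℝ} {T : ι → ι → ι → ℝ} {Q : ι → ι → ℝ}
    (hT : ∀ i j k, T i j k = T i k j) (hT' : ∀ i j k, T i j k = T j i k)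
    (h1 : ∀ i, y i * l i - γ * y i * l o - u / l o * T o o i = 0)
    (h2 : ∀ i, ∑ j, T j j i / l j = β * (y i * l i / u))
    (h3 : ∑ j, Q o j / l j - ∑ j, ∑ k, T j k o * T k j o / (l j * l k) =
      β * ((l o + ∑ k, y k * T o o k) / u - (y o * l o) ^ 2 / u ^ 2) +
        (Fintype.card ι + 2 - β) * l o ^ 2)
    (h4 : ∀ i, l i + ∑ k, y k * T i i k + 2 * u * ∑ k, (if k = o then 0 else -(T o k i / l k)) ^ 2
      + (if i = o then 2 * u * l o ^ 2 else 0) - γ * l o * (1 - u * l i) - 2 * γ * y i * T o o i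
      - u / l o * (Q o i + 4 * ∑ k, T o k i * (if k = o then 0 else -(T o k i / l k))
        + 2 * ∑ k, l k * (if k = o then 0 else -(T o k i / l k)) ^ 2) ≤ 0) :
    ∀ i, l i = l o ∧ y i = 0 := by
  have hlo := hl o
  -- The first-order condition expresses these third derivatives through the tangential part y.
  have hτ : ∀ i, T o o i = l o / u * (y i * (l i - γ * l o)) := by
    intro i
    have := h1 i
    field_simp at this ⊢
    linarith
  set X : ι → ι → ℝ := fun i k => T o k i with hXdef
  have hX : ∀ i k, X i k = X k i := fun i k => hT o k i
  have hXo : ∀ k, X o k = T o o k := fun k => hT o k o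
  have hTX : ∀ j k, T j k o = X j k := fun j k => by
    rw [hT j k o, hT' j o k, hT o j k]
  have hTX' : ∀ j k, T j k o * T k j o = X j k ^ 2 := fun j k => by
    rw [hTX, hTX k j, hX k j, sq]
  set A : ℝ := ∑ i, ∑ k, X i k ^ 2 / (l i * l k) with hA
  set B : ℝ := ∑ i, ∑ k,
    (if k = o then 0 else 2 * X i k ^ 2 * (1 / l k + l o / l k ^ 2) / l i) with hB
  have hAB : ∑ k, (if k = o then -(X o o ^ 2 / l o ^ 2) else 2 * X o k ^ 2 / l k ^ 2) ≤ B - A := by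
    refine (sum_third_derivatives_ge hl o hX).trans (le_of_eq ?_)
    simp only [Finset.sum_add_distrib, Finset.sum_neg_distrib, hA, hB]
    ring
  -- The second-order condition divided by l_i, with the contributions of the moving direction
  -- combined into one sum. Summing over i contracts with the inverse Hessian, the linearization of
  -- log det.
  have h5 : ∀ i, 1 + (∑ k, y k * T i i k) / l i + (if i = o then 2 * u * l o else 0)
      - γ * (l o / l i) + γ * l o * u - 2 * γ * (y i * T o o i / l i) - u / l o * (Q o i / l i)
      + u / l o * ∑ k, (if k = o then 0 else 2 * X i k ^ 2 * (1 / l k + l o / l k ^ 2) / l i) ≤ 0 := by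
    intro i
    have hli := hl i
    have e := h4 i
    have e1 : 2 * u * ∑ k, (if k = o then 0 else -(T o k i / l k)) ^ 2 -
        u / l o * (4 * ∑ k, T o k i * (if k = o then 0 else -(T o k i / l k))
        + 2 * ∑ k, l k * (if k = o then 0 else -(T o k i / l k)) ^ 2) =
        (u / l o * ∑ k, (if k = o then 0 else 2 * X i k ^ 2 * (1 / l k + l o / l k ^ 2) / l i))
          * l i := by
      simp only [Finset.mul_sum, Finset.sum_mul, ← Finset.sum_add_distrib, ← Finset.sum_sub_distrib]
      refine Finset.sum_congr rfl fun k _ => ?_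
      have := (hl k).ne'
      by_cases hk : k = o
      · simp [hk]
      · simp only [if_neg hk, hXdef]
        field_simp; ring
    have e2 : (if i = o then 2 * u * l o ^ 2 else 0) = (if i = o then 2 * u * l o else 0) * l i := by
      split_ifs with h
      · rw [h]; ring
      · ring
    rw [e2] at e
    refine nonpos_of_mul_nonpos_left (b := l i) ?_ hli
    refine le_trans (le_of_eq ?_) e
    rw [add_mul, ← e1]
    field_simp
    ring
  have h6 := Finset.sum_nonpos fun i (_ : i ∈ Finset.univ) => h5 i
  simp only [Finset.sum_add_distrib, Finset.sum_sub_distrib, ← Finset.mul_sum, ← hB, Finset.sum_const,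
    Finset.card_univ, nsmul_eq_mul, Finset.sum_ite_eq', Finset.mem_univ, if_true, mul_one] at h6
  have h7 : ∑ i, (∑ k, y k * T i i k) / l i = ∑ k, β * (y k ^ 2 * l k / u) := by
    simp only [Finset.sum_div]
    rw [Finset.sum_comm]
    refine Finset.sum_congr rfl fun k _ => ?_
    have := h2 k
    rw [show ∑ i, y k * T i i k / l i = y k * ∑ i, T i i k / l i by
      rw [Finset.mul_sum]; exact Finset.sum_congr rfl fun i _ => mul_div_assoc _ _ _, this]
    ring
  -- The twice differentiated equation trades the fourth derivatives for the quadratic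
  -- third-derivative term A and lower-order terms.
  have h8 : ∑ j, Q o j / l j = A + (β * ((l o + ∑ k, y k * T o o k) / u - (y o * l o) ^ 2 / u ^ 2) +
        (Fintype.card ι + 2 - β) * l o ^ 2) := by
    rw [← h3]
    simp only [hTX', hA]
    ring
  rw [h7, h8] at h6
  -- The total coefficient of (l_o/u) y_k² after substituting `hτ`.
  set e : ι → ℝ := fun k => if k = o then γ * β - 2 * γ * (1 - γ) + β - (1 - γ) ^ 2
    else γ * β + 2 * (1 - γ * l o / l k) ^ 2 - 2 * γ * (1 - γ * l o / l k) with he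
  have he0 : ∀ k, 0 < e k := by
    intro k
    have hn' : (2 : ℝ) ≤ Fintype.card ι := by exact_mod_cast hn
    simp only [he]
    split_ifs
    -- Here e_o = (1+γ)(β - (1-γ)), which is positive because n ≥ 2.
    · have : 2 * (1 - γ) ≤ β := by rw [hβγ]; exact mul_le_mul_of_nonneg_right hn' (by linarith)
      nlinarith
    -- With r = 1 - γ l_o/l_k, the coefficient is 2(r - γ/2)² + γ(β - γ/2), and β > 1/2 > γ/2.
    · nlinarith [sq_nonneg (2 * (1 - γ * l o / l k) - γ)]
  have h9 : ∑ k, (γ * (1 - l o / l k) + l o / u * (y k ^ 2 * e k)) ≤ 0 := by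
    have q1 : ∑ k, l o / u * (y k ^ 2 * e k) = (∑ k, β * (y k ^ 2 * l k / u))
        - 2 * γ * ∑ k, y k * T o o k / l k - β / l o * ∑ k, y k * T o o k
        + u / l o * (∑ k, (if k = o then -(X o o ^ 2 / l o ^ 2) else 2 * X o k ^ 2 / l k ^ 2))
        + β * l o * y o ^ 2 / u := by
      have q0 : β * l o * y o ^ 2 / u = ∑ k, if k = o then β * l o * y k ^ 2 / u else 0 := by simp
      rw [q0]
      simp only [Finset.mul_sum, ← Finset.sum_add_distrib, ← Finset.sum_sub_distrib]
      refine Finset.sum_congr rfl fun k _ => ?_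
      have := (hl k).ne'
      simp only [he, hXo, hτ]
      split_ifs with hk
      · subst hk
        field_simp; ring
      · field_simp; ring
    simp only [Finset.sum_add_distrib, Finset.sum_sub_distrib, ← Finset.mul_sum, Finset.sum_const,
      Finset.card_univ, nsmul_eq_mul, mul_one] at q1 ⊢
    rw [q1]
    have q2 := mul_le_mul_of_nonneg_left hAB (show 0 ≤ u / l o by positivity)
    refine le_trans ?_ h6
    set P := ∑ k, y k * T o o k
    have q3 : u / l o * (A + (β * ((l o + P) / u - (y o * l o) ^ 2 / u ^ 2) +
        (Fintype.card ι + 2 - β) * l o ^ 2)) = u / l o * A + β + β / l o * P - β * l o * y o ^ 2 / u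
        + (Fintype.card ι + 2 - β) * (l o * u) := by
      field_simp
      ring
    -- This relation makes the multiples of l_o u cancel, 2 + nγ - (n+2-β) = 0, and turns the
    -- constants n - β into nγ, which supplies the terms γ(1 - l_o/l_k).
    have q4 : (Fintype.card ι : ℝ) * γ = Fintype.card ι - β := by rw [hβγ]; ring
    have q5 : γ * l o * (Fintype.card ι * u) = (Fintype.card ι - β) * (l o * u) := by
      rw [← q4]; ring
    have q6 : ∑ k, β * (y k ^ 2 * l k / u) = β * ∑ k, y k ^ 2 * l k / u :=
      (Finset.mul_sum _ _ _).symm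
    rw [q3, q5, q6]
    linarith
  have h10 : ∀ k ∈ Finset.univ, 0 ≤ γ * (1 - l o / l k) + l o / u * (y k ^ 2 * e k) := by
    intro k _
    have := he0 k
    have : 0 ≤ 1 - l o / l k := by rw [sub_nonneg, div_le_one (hl k)]; exact ho k
    positivity
  intro k
  have h11 := (Finset.sum_eq_zero_iff_of_nonneg h10).1 (le_antisymm h9 (Finset.sum_nonneg h10)) k
    (Finset.mem_univ k)
  have h12 := he0 k
  have h13 : 0 ≤ 1 - l o / l k := by rw [sub_nonneg, div_le_one (hl k)]; exact ho k
  have h14 : 0 ≤ l o / u * (y k ^ 2 * e k) := by positivity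
  have h15 := mul_nonneg hγ.le h13
  constructor
  · have : γ * (1 - l o / l k) = 0 := by linarith
    have : 1 - l o / l k = 0 := (mul_eq_zero.1 this).resolve_left hγ.ne'
    have hlk := hl k
    field_simp at this
    linarith
  · have : l o / u * (y k ^ 2 * e k) = 0 := by linarith
    have : y k ^ 2 * e k = 0 := (mul_eq_zero.1 this).resolve_left (by positivity)
    exact pow_eq_zero_iff (two_ne_zero) |>.1 ((mul_eq_zero.1 this).resolve_right h12.ne')

end Algebra

/-! ### Directional derivatives and jets along lines -/

section DirectionalDerivative

variable {E : Type*} [NormedAddCommGroup E] [NormedSpace ℝ E]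

/-- The derivative of `f` in the direction `e`, as a function. -/
noncomputable def dirDeriv (e : E) (f : E → ℝ) : E → ℝ := fun x => fderiv ℝ f x e

theorem ContDiff.dirDeriv {f : E → ℝ} {m k : ℕ∞ω} (hf : ContDiff ℝ k f) (h : m + 1 ≤ k) (e : E) :
    ContDiff ℝ m (dirDeriv e f) :=
  (hf.fderiv_right h).clm_apply contDiff_const

theorem dirDeriv_dirDeriv {f : E → ℝ} (hf : ContDiff ℝ 2 f) (v w x : E) :
    dirDeriv v (dirDeriv w f) x = fderiv ℝ (fderiv ℝ f) x v w := by
  have hd : DifferentiableAt ℝ (fderiv ℝ f) x :=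
    (hf.fderiv_right (m := 1) (by norm_num)).differentiable (by norm_num) x
  unfold dirDeriv
  rw [fderiv_clm_apply hd (differentiableAt_const w)]
  simp

theorem dirDeriv_comm {f : E → ℝ} (hf : ContDiff ℝ 2 f) (e e' : E) :
    dirDeriv e (dirDeriv e' f) = dirDeriv e' (dirDeriv e f) := by
  ext x
  rw [dirDeriv_dirDeriv hf, dirDeriv_dirDeriv hf]
  exact (hf.contDiffAt (x := x)).isSymmSndFDerivAt (by simp) e e'

theorem hasDerivAt_line {f : E → ℝ} (hf : Differentiable ℝ f) (y e : E) (t : ℝ) :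
    HasDerivAt (fun t : ℝ => f (y + t • e)) (dirDeriv e f (y + t • e)) t := by
  have h1 : HasDerivAt (fun t : ℝ => y + t • e) e t := by
    simpa using ((hasDerivAt_id t).smul_const e).const_add y
  exact (hf (y + t • e)).hasFDerivAt.comp_hasDerivAt t h1

theorem hasJet_line {f : E → ℝ} (hf : ContDiff ℝ 2 f) (y e : E) :
    HasJet (fun t => f (y + t • e)) (f y) (dirDeriv e f y) (dirDeriv e (dirDeriv e f) y) := by
  refine ⟨fun t => dirDeriv e f (y + t • e), .of_forall fun t =>
    hasDerivAt_line (hf.differentiable (by norm_num)) y e t, by simp, by simp, ?_⟩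
  simpa using hasDerivAt_line ((hf.dirDeriv (m := 1) (by norm_num) e).differentiable
    (by norm_num)) y e 0

end DirectionalDerivative

theorem HasJet.congr_values {f : ℝ → ℝ} {a b c a' b' c' : ℝ} (h : HasJet f a b c) (ha : a = a')
    (hb : b = b') (hc : c = c') : HasJet f a' b' c' := ha ▸ hb ▸ hc ▸ h

theorem HasJet.value {f : ℝ → ℝ} {a b c : ℝ} (h : HasJet f a b c) : f 0 = a :=
  h.choose_spec.2.1

/-! ### Maximum principle in graph coordinates -/

/-- The maximum principle for a graph `φ` solving the shrinker equation. -/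
theorem umbilic_of_max_of_graph {n : ℕ} (hn : 2 ≤ n) {β γ : ℝ} (hγ : 0 < γ) (hγ1 : γ < 1)
    (hβγ : β = n * (1 - γ)) (hβ : 1 / 2 < β)
    {E : Type*} [NormedAddCommGroup E] [InnerProductSpace ℝ E] (b : OrthonormalBasis (Fin n) ℝ E)
    {φ : E → ℝ} (hφ : ContDiff ℝ 4 φ) {y₀ : E} {l : Fin n → ℝ} (hl : ∀ i, 0 < l i)
    {o : Fin n} (ho : ∀ i, l o ≤ l i)
    (h0 : ∀ k, dirDeriv (b k) φ y₀ = 0)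
    (hH : ∀ i j, dirDeriv (b j) (dirDeriv (b i) φ) y₀ = if i = j then l i else 0)
    (hu : φ y₀ < 0) {W : ℝ}
    (hW : -φ y₀ = (γ / 2 * (∑ k, inner ℝ (b k) y₀ ^ 2 + φ y₀ ^ 2) + W) * l o)
    (heq : ∀ᶠ y in 𝓝 y₀,
      Real.log (Matrix.of fun i j => dirDeriv (b j) (dirDeriv (b i) φ) y).det =
      β * Real.log (∑ k, inner ℝ (b k) y * dirDeriv (b k) φ y - φ y) +
        (n + 2 - β) / 2 * Real.log (1 + ∑ k, dirDeriv (b k) φ y ^ 2))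
    (hmax : ∀ᶠ y in 𝓝 y₀, ∀ c : Fin n → ℝ,
      (∑ k, inner ℝ (b k) y * dirDeriv (b k) φ y - φ y) *
        (∑ k, c k ^ 2 + (∑ k, c k * dirDeriv (b k) φ y) ^ 2) ≤
      (γ / 2 * (∑ k, inner ℝ (b k) y ^ 2 + φ y ^ 2) + W) *
        ∑ k, ∑ m, c k * c m * dirDeriv (b m) (dirDeriv (b k) φ) y) :
    ∀ i, l i = l o ∧ inner ℝ (b i) y₀ = 0 := by
  set u := -φ y₀ with hu_def
  have hu0 : 0 < u := neg_pos.2 hu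
  set y : Fin n → ℝ := fun k => inner ℝ (b k) y₀ with hy
  set H : Fin n → Fin n → E → ℝ := fun i j => dirDeriv (b j) (dirDeriv (b i) φ) with hHdef
  set T : Fin n → Fin n → Fin n → ℝ := fun i j k => dirDeriv (b k) (H i j) y₀ with hTdef
  have hp : ∀ k, ContDiff ℝ 3 (dirDeriv (b k) φ) := fun k => hφ.dirDeriv (by norm_num) _
  have hHc : ∀ i j, ContDiff ℝ 2 (H i j) := fun i j => (hp i).dirDeriv (by norm_num) _
  have hHs : ∀ i j, H i j = H j i := fun i j => dirDeriv_comm (hφ.of_le (by norm_num)) _ _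
  have hT1 : ∀ i j k, T i j k = T j i k := fun i j k => by simp only [hTdef, hHs i j]
  have hT2 : ∀ i j k, T i j k = T i k j := fun i j k =>
    congrFun (dirDeriv_comm ((hp i).of_le (by norm_num)) _ _) _
  have hline : ∀ i : Fin n, Tendsto (fun t : ℝ => y₀ + t • b i) (𝓝 0) (𝓝 y₀) := by
    intro i
    have : Continuous fun t : ℝ => y₀ + t • b i := by fun_prop
    simpa using this.tendsto 0
  -- jets along the line `y₀ + t b i`
  have jY : ∀ i k, HasJet (fun t => inner ℝ (b k) (y₀ + t • b i)) (y k)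
      (if k = i then 1 else 0) 0 := by
    intro i k
    have : (fun t : ℝ => inner ℝ (b k) (y₀ + t • b i)) =
        fun t => y k + (if k = i then 1 else 0) * t := by
      ext t
      rw [inner_add_right, inner_smul_right, orthonormal_iff_ite.1 b.orthonormal k i, mul_comm]
    rw [this]
    exact ((HasJet.const _).add (HasJet.id.const_mul _)).congr_values (by ring) (by ring) (by ring)
  have jφ : ∀ i, HasJet (fun t => φ (y₀ + t • b i)) (-u) 0 (l i) := by
    intro i
    refine (hasJet_line (hφ.of_le (by norm_num)) y₀ (b i)).congr_values (by simp [hu_def]) (h0 i) ?_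
    rw [hH, if_pos rfl]
  have jp : ∀ i k, HasJet (fun t => dirDeriv (b k) φ (y₀ + t • b i)) 0
      (if k = i then l k else 0) (T k i i) := fun i k =>
    (hasJet_line ((hp k).of_le (by norm_num)) y₀ (b i)).congr_values (h0 k) (hH k i) rfl
  have jH : ∀ i k m, HasJet (fun t => H k m (y₀ + t • b i))
      (if k = m then l k else 0) (T k m i) (dirDeriv (b i) (dirDeriv (b i) (H k m)) y₀) :=
    fun i k m => (hasJet_line (hHc k m) y₀ (b i)).congr_values (hH k m) rfl rfl
  have jE : ∀ i, HasJet (fun t => ∑ k, inner ℝ (b k) (y₀ + t • b i) *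
      dirDeriv (b k) φ (y₀ + t • b i) - φ (y₀ + t • b i)) u (y i * l i)
      (l i + ∑ k, y k * T i i k) := by
    intro i
    refine ((HasJet.sum _ fun k _ => (jY i k).mul (jp i k)).sub (jφ i)).congr_values ?_ ?_ ?_
    · simp
    · simp
    · simp only [Finset.sum_add_distrib, zero_mul, zero_add]
      have : ∀ k, T k i i = T i i k := fun k => by rw [hT1, hT2]
      simp only [this]
      simp
      ring
  have jψ : ∀ i, HasJet (fun t => 1 + ∑ k, dirDeriv (b k) φ (y₀ + t • b i) ^ 2) 1 0
      (2 * l i ^ 2) := by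
    intro i
    simp only [sq]
    refine ((HasJet.const 1).add (HasJet.sum _ fun k _ => (jp i k).mul (jp i k))).congr_values
      ?_ ?_ ?_
    · simp
    · simp
    · simp; ring
  have jeq : ∀ i, (∑ j, T j j i / l j = β * (y i * l i / u)) ∧
      (∑ j, dirDeriv (b i) (dirDeriv (b i) (H j j)) y₀ / l j
        - ∑ j, ∑ k, T j k i * T k j i / (l j * l k) =
      β * ((l i + ∑ k, y k * T i i k) / u - (y i * l i) ^ 2 / u ^ 2) + (n + 2 - β) * l i ^ 2) := by
    intro i
    have j1 := hasJet_log_det hl (jH i)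
    have j2 := (((jE i).log hu0).const_mul β).add
      (((jψ i).log one_pos).const_mul ((n + 2 - β) / 2))
    have := j1.unique (j2.congr (((hline i).eventually heq).mono fun t ht => ht.symm))
    refine ⟨this.1.trans (by ring), this.2.trans (by ring)⟩
  -- Test the Rayleigh inequality along y₀ + t b_i with direction e_o + t a. The normalization a_o =
  -- 0 removes the first-order variation of the direction's length and of its Hessian value coming
  -- from a.
  have jG : ∀ i, ∀ a : Fin n → ℝ, a o = 0 →
      (y i * l i - γ * y i * l o - u / l o * T o o i = 0) ∧
      (l i + ∑ k, y k * T i i k + 2 * u * ∑ k, a k ^ 2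
      + (if i = o then 2 * u * l o ^ 2 else 0) - γ * l o * (1 - u * l i) - 2 * γ * y i * T o o i
      - u / l o * (dirDeriv (b i) (dirDeriv (b i) (H o o)) y₀ + 4 * ∑ k, T o k i * a k
        + 2 * ∑ k, l k * a k ^ 2) ≤ 0) := by
    intro i a ha
    have jc : ∀ k, HasJet (fun t => (if k = o then 1 else 0) + a k * t)
        (if k = o then 1 else 0) (a k) 0 := fun k =>
      ((HasJet.const _).add (HasJet.id.const_mul _)).congr_values (by ring) (by ring) (by ring)
    have jcp := HasJet.sum Finset.univ fun k _ => (jc k).mul (jp i k)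
    have jM := (HasJet.sum Finset.univ fun k _ => (jc k).mul (jc k)).add (jcp.mul jcp)
    have jM' := jM.congr_values (a' := 1) (b' := 0)
      (c' := 2 * ∑ k, a k ^ 2 + (if i = o then 2 * l o ^ 2 else 0)) (by simp)
      (by simp [Finset.sum_add_distrib, ha]) (by
        simp only [Finset.sum_add_distrib]
        simp [Finset.mul_sum]
        rcases eq_or_ne i o with h | h
        · simp [h, sq, mul_assoc]
        · simp [h, sq, mul_assoc])
    have jR := (((HasJet.sum Finset.univ fun k _ => (jY i k).mul (jY i k)).add
      ((jφ i).mul (jφ i))).const_mul (γ / 2)).add (HasJet.const W)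
    have jR' := jR.congr_values (a' := u / l o) (b' := γ * y i) (c' := γ * (1 - u * l i))
      (by
        rw [eq_div_iff (hl o).ne']
        refine Eq.trans ?_ hW.symm
        simp only [sq, hy, hu_def]
        ring)
      (by simp [Finset.sum_add_distrib]; ring) (by simp; ring)
    have jS := HasJet.sum Finset.univ fun k _ => HasJet.sum Finset.univ fun m _ =>
      ((jc k).mul (jc m)).mul (jH i k m)
    have jS' := jS.congr_values (a' := l o) (b' := T o o i)
      (c' := dirDeriv (b i) (dirDeriv (b i) (H o o)) y₀ + 4 * ∑ k, T o k i * a k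
        + 2 * ∑ k, l k * a k ^ 2) (by simp)
      (by simp only [add_mul, Finset.sum_add_distrib]; simp [ha]) (by
        simp only [add_mul, mul_add, Finset.sum_add_distrib]
        simp
        simp only [hT1 _ o i]
        rw [add_comm, add_assoc, ← Finset.sum_add_distrib,
          Finset.mul_sum, Finset.mul_sum, add_comm (∑ k, 2 * _ * _ * _)]
        congr 2 <;> refine Finset.sum_congr rfl fun k _ => ?_ <;> ring)
    have jG := ((jE i).mul jM').sub (jR'.mul jS')
    have hm := jG.of_isLocalMax ?_
    · refine ⟨?_, ?_⟩
      · rw [← hm.1]; ring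
      · refine le_trans (le_of_eq ?_) hm.2
        split_ifs <;> ring
    · filter_upwards [(hline i).eventually hmax] with t ht
      have h1 := ht fun k => (if k = o then 1 else 0) + a k * t
      refine le_trans (b := 0) ?_ (le_of_eq ?_)
      · simp only [← sq]
        linarith
      · rw [jG.value, div_mul_cancel₀ _ (hl o).ne']; ring
  -- The first-order condition does not involve a, so a = 0 serves. For the second order, the
  -- optimal a_k = -T_oki / (l_k - l_o) breaks down when l_k = l_o; the denominator l_k is always
  -- admissible and still strong enough.
  refine umbilic_of_jet_inequalities (T := T)
    (Q := fun j i => dirDeriv (b i) (dirDeriv (b i) (H j j)) y₀) hl o ho (by simpa using hn) hu0 hγ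
    hγ1 (by simpa using hβγ) hβ hT2 hT1 (fun i => (jG i 0 rfl).1) (fun i => (jeq i).1) ?_ fun i =>
      (jG i (fun k => if k = o then 0 else -(T o k i / l k)) (if_pos rfl)).2
  -- Symmetry of fourth derivatives: the second derivatives of φ_oo along b_j are those of φ_jj
  -- along b_o, as produced by the equation.
  have hQ : ∀ j, dirDeriv (b j) (dirDeriv (b j) (H o o)) y₀ =
      dirDeriv (b o) (dirDeriv (b o) (H j j)) y₀ := by
    intro j
    simp only [hHdef]
    rw [dirDeriv_comm ((hp o).of_le (by norm_num)) (b j) (b o),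
      dirDeriv_comm (hφ.of_le (by norm_num)) (b j) (b o),
      dirDeriv_comm (hHc j o) (b j) (b o),
      dirDeriv_comm ((hp j).of_le (by norm_num)) (b j) (b o)]
  simp only [hQ]
  simpa using (jeq o).2

/-! ### Principal curvatures and Rayleigh quotients -/

section LinearAlgebra

variable {n : ℕ}

/-- Orthogonal diagonalization of a real symmetric matrix. -/
theorem exists_orthogonal_diagonalization {A : Matrix (Fin n) (Fin n) ℝ} (hA : A.IsHermitian) :
    ∃ (U : Matrix (Fin n) (Fin n) ℝ) (l : Fin n → ℝ), Uᵀ * U = 1 ∧ Uᵀ * A * U = diagonal l := by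
  refine ⟨hA.eigenvectorUnitary, hA.eigenvalues, ?_, ?_⟩
  · rw [← conjTranspose_eq_transpose_of_trivial]
    exact Unitary.coe_star_mul_self hA.eigenvectorUnitary
  · have := hA.conjStarAlgAut_star_eigenvectorUnitary
    rw [Unitary.conjStarAlgAut_apply] at this
    rw [← conjTranspose_eq_transpose_of_trivial]
    simpa [star_eq_conjTranspose, Function.comp_def] using this

/-- Simultaneous diagonalization of two positive definite matrices. -/
theorem exists_simultaneous_diagonalization {g h : Matrix (Fin n) (Fin n) ℝ} (hg : g.PosDef)
    (hh : h.PosDef) : ∃ (P : Matrix (Fin n) (Fin n) ℝ) (l : Fin n → ℝ), IsUnit P.det ∧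
      (∀ i, 0 < l i) ∧ Pᵀ * g * P = 1 ∧ Pᵀ * h * P = diagonal l := by
  have hdet : ∀ {P A B : Matrix (Fin n) (Fin n) ℝ}, Pᵀ * A * P = B → B.det ≠ 0 → IsUnit P.det := by
    intro P A B h1 h2
    rw [← h1, det_mul] at h2
    exact isUnit_iff_ne_zero.2 (right_ne_zero_of_mul h2)
  have hpos : ∀ {P A : Matrix (Fin n) (Fin n) ℝ} {l : Fin n → ℝ}, A.PosDef → IsUnit P.det →
      Pᵀ * A * P = diagonal l → ∀ i, 0 < l i := by
    intro P A l hA hP h1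
    have := (IsUnit.posDef_star_left_conjugate_iff (x := A) ((isUnit_iff_isUnit_det P).2 hP)).2 hA
    rw [star_eq_conjTranspose, conjTranspose_eq_transpose_of_trivial, h1] at this
    exact posDef_diagonal_iff.1 this
  obtain ⟨U, d, hU, hUg⟩ := exists_orthogonal_diagonalization hg.isHermitian
  have hd := hpos hg (hdet (A := 1) (B := 1) (by rwa [mul_one]) (by simp)) hUg
  -- Rescaling the eigenvectors of g turns g into the identity; a further orthogonal change of basis
  -- then diagonalizes h and preserves this.
  set D : Matrix (Fin n) (Fin n) ℝ := diagonal fun i => (√(d i))⁻¹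
  have h1 : (U * D)ᵀ * g * (U * D) = 1 := by
    have : (U * D)ᵀ * g * (U * D) = D * (Uᵀ * g * U) * D := by
      rw [transpose_mul, diagonal_transpose]; simp only [D, mul_assoc]
    rw [this, hUg, diagonal_mul_diagonal, diagonal_mul_diagonal, ← diagonal_one]
    congr 1
    ext i
    have h2 := Real.sqrt_pos.2 (hd i)
    have h3 := Real.sq_sqrt (hd i).le
    field_simp
    exact h3.symm
  have h2 : ((U * D)ᵀ * h * (U * D)).IsHermitian := by
    rw [← conjTranspose_eq_transpose_of_trivial]
    exact isHermitian_conjTranspose_mul_mul _ hh.isHermitian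
  obtain ⟨V, l, hV, hVh⟩ := exists_orthogonal_diagonalization h2
  have h3 : (U * D * V)ᵀ * g * (U * D * V) = 1 := by
    have : (U * D * V)ᵀ * g * (U * D * V) = Vᵀ * ((U * D)ᵀ * g * (U * D)) * V := by
      rw [transpose_mul _ V]; simp only [mul_assoc]
    rw [this, h1, mul_one, hV]
  have h4 : (U * D * V)ᵀ * h * (U * D * V) = diagonal l := by
    rw [← hVh, transpose_mul _ V]; simp only [mul_assoc]
  have h5 := hdet h3 (by simp)
  exact ⟨_, l, h5, hpos hh h5 h4, h3, h4⟩

/-- Since g⁻¹ = P Pᵀ, the matrix g⁻¹h = P(Pᵀh) has the same characteristic polynomial as Pᵀ h P. -/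
theorem roots_charpoly_of_diagonalization {g h P : Matrix (Fin n) (Fin n) ℝ} {l : Fin n → ℝ}
    (hP : IsUnit P.det) (h1 : Pᵀ * g * P = 1) (h2 : Pᵀ * h * P = diagonal l) :
    (g⁻¹ * h).charpoly.roots = Finset.univ.val.map l := by
  have hPt : IsUnit Pᵀ.det := by rwa [det_transpose]
  have e1 : g⁻¹ = P * Pᵀ := by
    refine inv_eq_left_inv ?_
    have : P * (Pᵀ * g * P) * P⁻¹ = P * P⁻¹ := by rw [h1, mul_one]
    rw [mul_nonsing_inv _ hP] at this
    simpa only [mul_assoc, mul_nonsing_inv _ hP, mul_one] using this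
  rw [e1, mul_assoc, charpoly_mul_comm, h2, charpoly_diagonal]
  have := Polynomial.roots_multiset_prod_X_sub_C (Finset.univ.val.map l)
  rwa [Multiset.map_map] at this

/-- The Rayleigh quotients `g(v, v) / h(v, v)`. -/
def rayleighSet (g h : Matrix (Fin n) (Fin n) ℝ) : Set ℝ :=
  {m | ∃ v : Fin n → ℝ, v ≠ 0 ∧ v ⬝ᵥ g *ᵥ v = m * (v ⬝ᵥ h *ᵥ v)}

theorem dotProduct_congruence (J g : Matrix (Fin n) (Fin n) ℝ) (v : Fin n → ℝ) :
    v ⬝ᵥ (Jᵀ * g * J) *ᵥ v = (J *ᵥ v) ⬝ᵥ g *ᵥ (J *ᵥ v) := by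
  rw [← mulVec_mulVec, ← mulVec_mulVec, dotProduct_mulVec, vecMul_transpose]

/-- A change of basis merely relabels the test vectors. This allows chart quantities to be computed
in graph coordinates. -/
theorem rayleighSet_congruence {J : Matrix (Fin n) (Fin n) ℝ} (hJ : IsUnit J.det)
    (g h : Matrix (Fin n) (Fin n) ℝ) :
    rayleighSet (Jᵀ * g * J) (Jᵀ * h * J) = rayleighSet g h := by
  have hinj : ∀ v : Fin n → ℝ, v ≠ 0 → J *ᵥ v ≠ 0 := fun v hv h0 =>
    hv (mulVec_injective_of_isUnit ((isUnit_iff_isUnit_det J).2 hJ) (h0.trans (mulVec_zero J).symm))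
  ext m
  simp only [rayleighSet, Set.mem_ofPred_eq, dotProduct_congruence]
  constructor
  · rintro ⟨v, hv, h1⟩
    exact ⟨_, hinj v hv, h1⟩
  · rintro ⟨v, hv, h1⟩
    have e : J *ᵥ (J⁻¹ *ᵥ v) = v := by
      rw [mulVec_mulVec, mul_nonsing_inv _ hJ, one_mulVec]
    refine ⟨J⁻¹ *ᵥ v, ?_, by rwa [e]⟩
    intro h0
    rw [h0, mulVec_zero] at e
    exact hv e.symm

theorem isGreatest_rayleighSet_diagonal {l : Fin n → ℝ} (hl : ∀ i, 0 < l i) {o : Fin n}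
    (ho : ∀ i, l o ≤ l i) : IsGreatest (rayleighSet 1 (diagonal l)) (1 / l o) := by
  have key : ∀ v : Fin n → ℝ, v ⬝ᵥ (diagonal l) *ᵥ v = ∑ i, l i * v i ^ 2 := fun v => by
    simp only [dotProduct, mulVec_diagonal]
    exact Finset.sum_congr rfl fun i _ => by ring
  have key1 : ∀ v : Fin n → ℝ, v ⬝ᵥ (1 : Matrix (Fin n) (Fin n) ℝ) *ᵥ v = ∑ i, v i ^ 2 := fun v => by
    simp only [dotProduct, one_mulVec, sq]
  constructor
  · refine ⟨Pi.single o 1, by simp, ?_⟩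
    rw [key, key1, Finset.sum_eq_single o, Finset.sum_eq_single o]
    · have := (hl o).ne'
      simp only [Pi.single_eq_same]
      field_simp
    all_goals simp +contextual
  · rintro m ⟨v, hv, h1⟩
    rw [key, key1] at h1
    have h2 : 0 < ∑ i, v i ^ 2 := by
      obtain ⟨i, hi⟩ := Function.ne_iff.1 hv
      exact Finset.sum_pos' (fun _ _ => sq_nonneg _) ⟨i, Finset.mem_univ i, by
        have : v i ≠ 0 := hi
        positivity⟩
    have h3 : l o * ∑ i, v i ^ 2 ≤ ∑ i, l i * v i ^ 2 := by
      rw [Finset.mul_sum]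
      exact Finset.sum_le_sum fun i _ => mul_le_mul_of_nonneg_right (ho i) (sq_nonneg _)
    have hlo := hl o
    have h4 : 0 < ∑ i, l i * v i ^ 2 := lt_of_lt_of_le (by positivity) h3
    rw [le_div_iff₀ hlo]
    by_contra! h5
    have : m * ∑ i, l i * v i ^ 2 ≤ (1 / l o) * ∑ i, l i * v i ^ 2 := by
      by_contra! h6
      have h7 := mul_le_mul_of_nonneg_left h3 (show 0 ≤ m by
        by_contra! h8; nlinarith)
      nlinarith
    nlinarith

/-- The principal curvatures are positive, and the largest principal radius is the largest Rayleigh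
quotient. -/
theorem exists_principal_curvatures (hn : 0 < n) {g h : Matrix (Fin n) (Fin n) ℝ} (hg : g.PosDef)
    (hh : h.PosDef) : ∃ (P : Matrix (Fin n) (Fin n) ℝ) (l : Fin n → ℝ) (o : Fin n),
      IsUnit P.det ∧ (∀ i, 0 < l i) ∧ (∀ i, l o ≤ l i) ∧ Pᵀ * g * P = 1 ∧ Pᵀ * h * P = diagonal l ∧
      (g⁻¹ * h).charpoly.roots = Finset.univ.val.map l ∧
      IsGreatest (rayleighSet g h) (1 / l o) := by
  obtain ⟨P, l, hP, hl, h1, h2⟩ := exists_simultaneous_diagonalization hg hh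
  have : Nonempty (Fin n) := ⟨⟨0, hn⟩⟩
  obtain ⟨o, ho⟩ := Finite.exists_min l
  refine ⟨P, l, o, hP, hl, ho, h1, h2, roots_charpoly_of_diagonalization hP h1 h2, ?_⟩
  rw [← rayleighSet_congruence hP, h1, h2]
  exact isGreatest_rayleighSet_diagonal hl ho

theorem prod_roots_charpoly (hn : 0 < n) {g h : Matrix (Fin n) (Fin n) ℝ} (hg : g.PosDef)
    (hh : h.PosDef) : (g⁻¹ * h).charpoly.roots.prod = h.det / g.det := by
  obtain ⟨P, l, o, hP, hl, ho, h1, h2, h3, h4⟩ := exists_principal_curvatures hn hg hh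
  have e1 := congrArg det h1
  have e2 := congrArg det h2
  rw [det_mul, det_mul, det_transpose] at e1 e2
  rw [h3, ← Finset.prod_eq_multiset_prod, ← det_diagonal, ← e2, eq_div_iff hg.det_pos.ne']
  rw [det_one] at e1
  linear_combination h.det * e1

theorem isGreatest_sSup_rayleighSet (hn : 0 < n) {g h : Matrix (Fin n) (Fin n) ℝ} (hg : g.PosDef)
    (hh : h.PosDef) : IsGreatest (rayleighSet g h) (sSup (rayleighSet g h)) := by
  obtain ⟨P, l, o, hP, hl, ho, h1, h2, h3, h4⟩ := exists_principal_curvatures hn hg hh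
  rwa [h4.csSup_eq]

/-- Each principal radius is at most the largest one; this is the source of f ≤ n w. -/
theorem sum_inv_roots_charpoly_le (hn : 0 < n) {g h : Matrix (Fin n) (Fin n) ℝ} (hg : g.PosDef)
    (hh : h.PosDef) :
    ((g⁻¹ * h).charpoly.roots.map fun l => l⁻¹).sum ≤ n * sSup (rayleighSet g h) := by
  obtain ⟨P, l, o, hP, hl, ho, h1, h2, h3, h4⟩ := exists_principal_curvatures hn hg hh
  rw [h4.csSup_eq, h3, Multiset.map_map, ← Finset.sum_eq_multiset_sum]
  refine (Finset.sum_le_sum fun i _ => (?_ : _ ≤ 1 / l o)).trans (by simp)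
  rw [Function.comp_apply, one_div]
  exact inv_anti₀ (hl o) (ho i)

theorem sum_inv_roots_charpoly_of_eq_smul (hn : 0 < n) {g h : Matrix (Fin n) (Fin n) ℝ}
    (hg : g.PosDef) (hh : h.PosDef) {κ : ℝ} (hκ : h = κ • g) :
    ((g⁻¹ * h).charpoly.roots.map fun l => l⁻¹).sum = n * sSup (rayleighSet g h) := by
  obtain ⟨P, l, o, hP, hl, ho, h1, h2, h3, h4⟩ := exists_principal_curvatures hn hg hh
  have e : ∀ i, l i = κ := by
    intro i
    rw [hκ, mul_smul_comm, smul_mul_assoc, h1] at h2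
    simpa using (congrFun (congrFun h2 i) i).symm
  rw [h4.csSup_eq, h3, Multiset.map_map, ← Finset.sum_eq_multiset_sum]
  simp [e]

end LinearAlgebra

/-! ### Geometry of a parametrized graph -/

section Graph

variable {E V : Type*} [NormedAddCommGroup E] [InnerProductSpace ℝ E]
  [NormedAddCommGroup V] [InnerProductSpace ℝ V]

/-- `π` is the orthogonal projection along the unit vector `ν`, up to an identification of the
orthogonal complement of `ν` with `E`. -/
def IsProjectionAlong (π : V →L[ℝ] E) (ν : V) : Prop :=
  ∀ z z' : V, inner ℝ z z' = inner ℝ (π z) (π z') + inner ℝ z ν * inner ℝ z' ν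

/-- Every smooth germ is the germ of a globally `C⁴` function. -/
theorem exists_contDiff_eventuallyEq [FiniteDimensional ℝ E] {f : E → ℝ} {y : E}
    (hf : ContDiffAt ℝ 4 f y) : ∃ g : E → ℝ, ContDiff ℝ 4 g ∧ g =ᶠ[𝓝 y] f := by
  have h1 : ∀ᶠ z in 𝓝 y, ContDiffAt ℝ 4 f z := hf.eventually (by simp)
  obtain ⟨r, hr, hball⟩ := Metric.eventually_nhds_iff_ball.1 h1
  let B : ContDiffBump y := ⟨r / 3, r / 2, by positivity, by linarith⟩
  refine ⟨fun z => B z * f z, contMDiff_iff_contDiff.1 (contMDiff_of_tsupport fun z hz =>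
    contMDiffAt_iff_contDiffAt.2 ?_), ?_⟩
  · have hz' : z ∈ Metric.closedBall y (r / 2) := by
      have h2 : tsupport (fun z => B z * f z) ⊆ tsupport B := tsupport_mul_subset_left
      have h3 := h2 hz
      rwa [B.tsupport_eq] at h3
    exact B.contDiffAt.mul (hball z (Metric.closedBall_subset_ball (by linarith) hz'))
  · filter_upwards [B.eventuallyEq_one] with z hz
    simp [hz]

variable {π : V →L[ℝ] E} {ν N : V} {X : E → V} {x : E} {φ : E → ℝ}

/-- The chain rule applied to the graph relation. It is needed on a neighbourhood because it is
differentiated again for the second fundamental form. -/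
theorem inner_fderiv_of_graph (hX : ContDiffAt ℝ 2 X x) (hφ : ContDiff ℝ 2 φ)
    (hgraph : ∀ᶠ z in 𝓝 x, inner ℝ (X z) ν = φ (π (X z))) :
    ∀ᶠ z in 𝓝 x, ∀ v, inner ℝ (fderiv ℝ X z v) ν = fderiv ℝ φ (π (X z)) (π (fderiv ℝ X z v)) := by
  filter_upwards [hgraph.eventually_nhds, hX.eventually (by simp)] with z hz hXz v
  have hd := hXz.differentiableAt (by norm_num)
  have h1 : HasFDerivAt (fun z => inner ℝ (X z) ν) ((innerSL ℝ ν).comp (fderiv ℝ X z)) z := by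
    have := (innerSL ℝ ν).hasFDerivAt.comp z hd.hasFDerivAt
    refine this.congr_of_eventuallyEq (.of_forall fun w => ?_)
    exact real_inner_comm _ _
  have h2 : HasFDerivAt (fun z => φ (π (X z)))
      ((fderiv ℝ φ (π (X z))).comp (π.comp (fderiv ℝ X z))) z :=
    ((hφ.differentiable (by norm_num)) _).hasFDerivAt.comp z (π.hasFDerivAt.comp z hd.hasFDerivAt)
  have h3 := h1.unique (h2.congr_of_eventuallyEq hz)
  rw [real_inner_comm]
  exact congrArg (fun T : E →L[ℝ] ℝ => T v) h3

theorem injective_projection_fderiv (hπ : IsProjectionAlong π ν) (hX : ContDiffAt ℝ 2 X x)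
    (hφ : ContDiff ℝ 2 φ) (hgraph : ∀ᶠ z in 𝓝 x, inner ℝ (X z) ν = φ (π (X z)))
    (hinj : Function.Injective (fderiv ℝ X x)) :
    Function.Injective fun v => π (fderiv ℝ X x v) := by
  have h := (inner_fderiv_of_graph hX hφ hgraph).self_of_nhds
  refine (injective_iff_map_eq_zero (π.comp (fderiv ℝ X x))).2 fun v hv => ?_
  have hv' : π (fderiv ℝ X x v) = 0 := hv
  have h1 := h v
  rw [hv', map_zero] at h1
  have h2 := hπ (fderiv ℝ X x v) (fderiv ℝ X x v)
  rw [hv', h1, inner_zero_left, mul_zero, add_zero, inner_self_eq_zero] at h2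
  exact hinj (h2.trans (map_zero _).symm)

theorem firstForm_of_graph (hπ : IsProjectionAlong π ν) (hX : ContDiffAt ℝ 2 X x)
    (hφ : ContDiff ℝ 2 φ) (hgraph : ∀ᶠ z in 𝓝 x, inner ℝ (X z) ν = φ (π (X z))) (v w : E) :
    inner ℝ (fderiv ℝ X x v) (fderiv ℝ X x w) =
      inner ℝ (π (fderiv ℝ X x v)) (π (fderiv ℝ X x w)) +
        fderiv ℝ φ (π (X x)) (π (fderiv ℝ X x v)) * fderiv ℝ φ (π (X x)) (π (fderiv ℝ X x w)) := by
  have h := (inner_fderiv_of_graph hX hφ hgraph).self_of_nhds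
  rw [hπ, h, h]

/-- Orthogonality of N to tangent vectors fixes its pairing with their projections, and by
injectivity and equal dimensions these fill E. So πN = -⟨N,ν⟩∇φ. -/
theorem projection_normal_of_graph [FiniteDimensional ℝ E] (hπ : IsProjectionAlong π ν)
    (hX : ContDiffAt ℝ 2 X x)
    (hφ : ContDiff ℝ 2 φ) (hgraph : ∀ᶠ z in 𝓝 x, inner ℝ (X z) ν = φ (π (X z)))
    (hinj : Function.Injective (fderiv ℝ X x)) (hN : ∀ v, inner ℝ (fderiv ℝ X x v) N = 0) (w : E) :
    inner ℝ w (π N) = -(inner ℝ N ν * fderiv ℝ φ (π (X x)) w) := by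
  have h := (inner_fderiv_of_graph hX hφ hgraph).self_of_nhds
  have hJ := injective_projection_fderiv hπ hX hφ hgraph hinj
  obtain ⟨v, rfl⟩ := (LinearMap.injective_iff_surjective
    (f := (π.comp (fderiv ℝ X x) : E →ₗ[ℝ] E))).1 hJ w
  have h1 := hN v
  rw [hπ, h] at h1
  change inner ℝ (π (fderiv ℝ X x v)) (π N) = -(_ * fderiv ℝ φ _ (π (fderiv ℝ X x v)))
  linarith

/-- With N frozen, ⟨∂_w X, N⟩ equals ⟨N,ν⟩ times the increment of dφ from the base point, applied to
π ∂_w X. The increment vanishes at x, so only D²φ survives differentiation and no second derivative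
of X remains. -/
theorem secondForm_of_graph [FiniteDimensional ℝ E] (hπ : IsProjectionAlong π ν)
    (hX : ContDiffAt ℝ 2 X x)
    (hφ : ContDiff ℝ 2 φ) (hgraph : ∀ᶠ z in 𝓝 x, inner ℝ (X z) ν = φ (π (X z)))
    (hinj : Function.Injective (fderiv ℝ X x)) (hN : ∀ v, inner ℝ (fderiv ℝ X x v) N = 0) (v w : E) :
    inner ℝ (fderiv ℝ (fderiv ℝ X) x v w) N = inner ℝ N ν *
      fderiv ℝ (fderiv ℝ φ) (π (X x)) (π (fderiv ℝ X x v)) (π (fderiv ℝ X x w)) := by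
  have hpn := projection_normal_of_graph hπ hX hφ hgraph hinj hN
  have hd := (hX.differentiableAt (by norm_num)).hasFDerivAt
  have hd2 : HasFDerivAt (fderiv ℝ X) (fderiv ℝ (fderiv ℝ X) x) x :=
    ((hX.fderiv_right (m := 1) (by norm_num)).differentiableAt (by norm_num)).hasFDerivAt
  have hφ2 : HasFDerivAt (fderiv ℝ φ) (fderiv ℝ (fderiv ℝ φ) (π (X x))) (π (X x)) :=
    ((hφ.fderiv_right (m := 1) (by norm_num)).differentiable (by norm_num) _).hasFDerivAt
  have hXw : HasFDerivAt (fun z => fderiv ℝ X z w) ((fderiv ℝ (fderiv ℝ X) x).flip w) x := by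
    simpa using hd2.clm_apply (hasFDerivAt_const w x)
  have h1 : HasFDerivAt (fun z => inner ℝ (fderiv ℝ X z w) N)
      ((innerSL ℝ N).comp ((fderiv ℝ (fderiv ℝ X) x).flip w)) x := by
    refine ((innerSL ℝ N).hasFDerivAt.comp x hXw).congr_of_eventuallyEq (.of_forall fun z => ?_)
    exact real_inner_comm _ _
  have h2 : HasFDerivAt (fun z => (fderiv ℝ φ (π (X z)) - fderiv ℝ φ (π (X x))) (π (fderiv ℝ X z w)))
      _ x := ((hφ2.comp x (π.hasFDerivAt.comp x hd)).sub_const _).clm_apply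
        (π.hasFDerivAt.comp x hXw)
  have h3 := h2.const_mul (inner ℝ N ν)
  have h4 := h1.unique (h3.congr_of_eventuallyEq ?_)
  · rw [real_inner_comm]
    refine (congrArg (fun T : E →L[ℝ] ℝ => T v) h4).trans ?_
    simp
  · filter_upwards [inner_fderiv_of_graph hX hφ hgraph] with z hz
    rw [hπ, hz, hpn, _root_.sub_apply]
    ring

theorem norm_normal_of_graph [FiniteDimensional ℝ E] (hπ : IsProjectionAlong π ν)
    (hX : ContDiffAt ℝ 2 X x)
    (hφ : ContDiff ℝ 2 φ) (hgraph : ∀ᶠ z in 𝓝 x, inner ℝ (X z) ν = φ (π (X z)))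
    (hinj : Function.Injective (fderiv ℝ X x)) (hN : ∀ v, inner ℝ (fderiv ℝ X x v) N = 0)
    (hN1 : ‖N‖ = 1) {ι : Type*} [Fintype ι] (b : OrthonormalBasis ι ℝ E) :
    inner ℝ N ν ^ 2 * (1 + ∑ k, fderiv ℝ φ (π (X x)) (b k) ^ 2) = 1 := by
  have hpn := projection_normal_of_graph hπ hX hφ hgraph hinj hN
  have h1 := hπ N N
  rw [real_inner_self_eq_norm_sq, real_inner_self_eq_norm_sq, hN1, ← b.sum_sq_norm_inner_right] at h1
  simp only [hpn, Real.norm_eq_abs, sq_abs, neg_sq, mul_pow, ← Finset.mul_sum] at h1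
  linarith

theorem support_of_graph [FiniteDimensional ℝ E] (hπ : IsProjectionAlong π ν)
    (hX : ContDiffAt ℝ 2 X x)
    (hφ : ContDiff ℝ 2 φ) (hgraph : ∀ᶠ z in 𝓝 x, inner ℝ (X z) ν = φ (π (X z)))
    (hinj : Function.Injective (fderiv ℝ X x)) (hN : ∀ v, inner ℝ (fderiv ℝ X x v) N = 0) :
    -inner ℝ (X x) N =
      inner ℝ N ν * (fderiv ℝ φ (π (X x)) (π (X x)) - φ (π (X x))) := by
  rw [hπ, projection_normal_of_graph hπ hX hφ hgraph hinj hN, hgraph.self_of_nhds]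
  ring

theorem exists_isProjectionAlong {n : ℕ} {ν : EuclideanSpace ℝ (Fin (n + 1))} (hν : ‖ν‖ = 1) :
    ∃ π : EuclideanSpace ℝ (Fin (n + 1)) →L[ℝ] EuclideanSpace ℝ (Fin n),
      IsProjectionAlong π ν := by
  have : Fact (Module.finrank ℝ (EuclideanSpace ℝ (Fin (n + 1))) = n + 1) := ⟨by simp⟩
  let b := OrthonormalBasis.fromOrthogonalSpanSingleton (𝕜 := ℝ) n
    (show ν ≠ 0 from fun h => by simp [h] at hν)
  refine ⟨(b.repr.toContinuousLinearEquiv : _ →L[ℝ] _).comp (ℝ ∙ ν)ᗮ.orthogonalProjectionOnto,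
    fun z z' => ?_⟩
  have h1 : ∀ z, (((ℝ ∙ ν)ᗮ.orthogonalProjectionOnto z : (ℝ ∙ ν)ᗮ) :
      EuclideanSpace ℝ (Fin (n + 1))) = z - inner ℝ ν z • ν := fun z => by
    rw [← Submodule.starProjection_unit_singleton ℝ hν, ← Submodule.starProjection_orthogonal_val]
    rfl
  have h2 : inner ℝ (b.repr ((ℝ ∙ ν)ᗮ.orthogonalProjectionOnto z))
      (b.repr ((ℝ ∙ ν)ᗮ.orthogonalProjectionOnto z')) =
      inner ℝ (z - inner ℝ ν z • ν) (z' - inner ℝ ν z' • ν) := by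
    rw [b.repr.inner_map_map, Submodule.coe_inner, h1, h1]
  refine Eq.trans ?_ (congrArg (· + _) h2.symm)
  simp only [inner_sub_left, inner_sub_right, inner_smul_left, inner_smul_right,
    real_inner_self_eq_norm_sq, hν, real_inner_comm ν, RCLike.conj_to_real]
  ring

end Graph

/-! ### Local graph representation of the immersion -/

section Manifold

variable {n : ℕ} {M : Type*} [TopologicalSpace M] [ChartedSpace (EuclideanSpace ℝ (Fin n)) M]
  {F N : M → EuclideanSpace ℝ (Fin (n + 1))}

theorem contDiffAt_comp_extChartAt_symm [IsManifold (𝓡 n) ∞ M]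
    (hF : ContMDiff (𝓡 n) (𝓡 (n + 1)) ∞ F) (p : M) :
    ContDiffAt ℝ ∞ (F ∘ (extChartAt (𝓡 n) p).symm) (extChartAt (𝓡 n) p p) := by
  have h := (contMDiffAt_iff.1 (hF p)).2
  simpa only [extChartAt_model_space_eq_id, PartialEquiv.refl_coe, Function.id_comp,
    modelWithCornersSelf_coe, Set.range_id, contDiffWithinAt_univ] using h

theorem mfderiv_eq_fderiv_extChartAt [IsManifold (𝓡 n) ∞ M]
    (hF : ContMDiff (𝓡 n) (𝓡 (n + 1)) ∞ F) (p : M) :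
    mfderiv (𝓡 n) (𝓡 (n + 1)) F p =
      fderiv ℝ (F ∘ (extChartAt (𝓡 n) p).symm) (extChartAt (𝓡 n) p p) := by
  have h := (hF p).mdifferentiableAt (by simp)
  simp only [mfderiv, h, writtenInExtChartAt, extChartAt_model_space_eq_id,
    PartialEquiv.refl_coe, Function.id_comp, modelWithCornersSelf_coe, Set.range_id, fderivWithin_univ]
  rfl

theorem tendsto_extChartAt_symm (p : M) :
    Tendsto (extChartAt (𝓡 n) p).symm (𝓝 (extChartAt (𝓡 n) p p)) (𝓝 p) := by
  have := (continuousAt_extChartAt_symm (I := 𝓡 n) p).tendsto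
  rwa [extChartAt_to_inv] at this

/-- The projected parametrization has invertible differential at q, and the inverse function theorem
gives φ as the height over the hyperplane. The local section σ transfers statements near q to
statements near π(F q). -/
theorem exists_graph [IsManifold (𝓡 n) ∞ M]
    (hF : ContMDiff (𝓡 n) (𝓡 (n + 1)) ∞ F)
    (hFimm : ∀ p, Function.Injective (mfderiv (𝓡 n) (𝓡 (n + 1)) F p)) {q : M}
    {ν : EuclideanSpace ℝ (Fin (n + 1))}
    (hν : ∀ v, inner ℝ (fderiv ℝ (F ∘ (extChartAt (𝓡 n) q).symm) (extChartAt (𝓡 n) q q) v) ν = 0)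
    {π : EuclideanSpace ℝ (Fin (n + 1)) →L[ℝ] EuclideanSpace ℝ (Fin n)}
    (hπ : IsProjectionAlong π ν) :
    ∃ φ : EuclideanSpace ℝ (Fin n) → ℝ, ContDiff ℝ 4 φ ∧
      (∀ᶠ p in 𝓝 q, inner ℝ (F p) ν = φ (π (F p))) ∧
      ∃ σ : EuclideanSpace ℝ (Fin n) → M, Tendsto σ (𝓝 (π (F q))) (𝓝 q) ∧
        ∀ᶠ y in 𝓝 (π (F q)), π (F (σ y)) = y := by
  set X := F ∘ (extChartAt (𝓡 n) q).symm with hXdef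
  set x := extChartAt (𝓡 n) q q with hx
  have hX := contDiffAt_comp_extChartAt_symm hF q
  rw [← hXdef, ← hx] at hX
  have hXx : X x = F q := by simp [hXdef, hx]
  have hinj : Function.Injective (fderiv ℝ X x) := by
    rw [← mfderiv_eq_fderiv_extChartAt hF q]; exact hFimm q
  have hJ : Function.Injective ((π.comp (fderiv ℝ X x)).toLinearMap) := by
    refine (injective_iff_map_eq_zero _).2 fun v hv => ?_
    have hv' : π (fderiv ℝ X x v) = 0 := hv
    have h2 := hπ (fderiv ℝ X x v) (fderiv ℝ X x v)
    rw [hv', hν, inner_zero_left, mul_zero, add_zero, inner_self_eq_zero] at h2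
    exact hinj (h2.trans (map_zero _).symm)
  let e : EuclideanSpace ℝ (Fin n) ≃L[ℝ] EuclideanSpace ℝ (Fin n) :=
    (LinearEquiv.ofInjectiveEndo _ hJ).toContinuousLinearEquiv
  have hψ : ContDiffAt ℝ ∞ (fun z => π (X z)) x := π.contDiff.contDiffAt.comp x hX
  have hψ' : HasFDerivAt (fun z => π (X z)) (e : _ →L[ℝ] _) x := by
    have h1 : (e : EuclideanSpace ℝ (Fin n) →L[ℝ] EuclideanSpace ℝ (Fin n)) =
        π.comp (fderiv ℝ X x) := by ext1 v; rfl
    rw [h1]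
    exact π.hasFDerivAt.comp x (hX.differentiableAt (by simp)).hasFDerivAt
  have hs : HasStrictFDerivAt (fun z => π (X z)) (e : _ →L[ℝ] _) x :=
    hψ.hasStrictFDerivAt' hψ' (by simp)
  set τ := hψ.localInverse hψ' (by simp) with hτ
  have hτc : ContDiffAt ℝ ∞ τ (π (X x)) := hψ.to_localInverse hψ' (by simp)
  have hτx : τ (π (X x)) = x := hs.localInverse_apply_image
  have hτ1 : ∀ᶠ z in 𝓝 x, τ (π (X z)) = z := hs.eventually_left_inverse
  have hτ2 : ∀ᶠ y in 𝓝 (π (X x)), π (X (τ y)) = y := hs.eventually_right_inverse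
  have hφ0 : ContDiffAt ℝ 4 (fun y => inner ℝ (X (τ y)) ν) (π (X x)) := by
    have h1 : ContDiffAt ℝ ∞ (fun y => X (τ y)) (π (X x)) := by
      refine ContDiffAt.comp (g := X) _ ?_ hτc
      rwa [hτx]
    exact (h1.inner ℝ contDiffAt_const).of_le (WithTop.coe_le_coe.2 (le_top : (4 : ℕ∞) ≤ ⊤))
  obtain ⟨φ, hφ, hφe⟩ := exists_contDiff_eventuallyEq hφ0
  rw [← hXx]
  refine ⟨φ, hφ, ?_, fun y => (extChartAt (𝓡 n) q).symm (τ y), ?_, hτ2⟩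
  · have h1 : Tendsto (extChartAt (𝓡 n) q) (𝓝 q) (𝓝 x) := continuousAt_extChartAt q
    have h2 : Tendsto (fun z => π (X z)) (𝓝 x) (𝓝 (π (X x))) := hψ'.continuousAt
    filter_upwards [h1.eventually hτ1, h1.eventually (h2.eventually hφe),
      extChartAt_source_mem_nhds (I := 𝓡 n) q] with p hp1 hp2 hp3
    have h3 : X (extChartAt (𝓡 n) q p) = F p := by
      simp only [hXdef, Function.comp_apply]
      rw [(extChartAt (𝓡 n) q).left_inv hp3]
    rw [hp1, h3] at hp2
    exact hp2.symm
  · have h1 : Tendsto τ (𝓝 (π (X x))) (𝓝 x) := by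
      have := hτc.continuousAt.tendsto
      rwa [hτx] at this
    exact (tendsto_extChartAt_symm q).comp h1

end Manifold

/-! ### Fundamental forms in graph coordinates -/

section GraphForms

variable {n : ℕ} {E : Type*} [NormedAddCommGroup E] [InnerProductSpace ℝ E]

/-- The first fundamental form of the graph of `φ`, in the basis `b`. -/
noncomputable def graphMetric (b : OrthonormalBasis (Fin n) ℝ E) (φ : E → ℝ) (y : E) :
    Matrix (Fin n) (Fin n) ℝ :=
  of fun k m => (if k = m then 1 else 0) + dirDeriv (b k) φ y * dirDeriv (b m) φ y

/-- The Hessian of `φ`, in the basis `b`. -/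
noncomputable def graphHessian (b : OrthonormalBasis (Fin n) ℝ E) (φ : E → ℝ) (y : E) :
    Matrix (Fin n) (Fin n) ℝ :=
  of fun k m => dirDeriv (b m) (dirDeriv (b k) φ) y

theorem gram_eq_congruence (b : OrthonormalBasis (Fin n) ℝ E) (B : E →L[ℝ] E →L[ℝ] ℝ)
    (v : Fin n → E) :
    (of fun i j => B (v i) (v j)) = (of fun k i => inner ℝ (b k) (v i))ᵀ *
      (of fun k m => B (b k) (b m)) * (of fun k i => inner ℝ (b k) (v i)) := by
  ext i j
  rw [of_apply]
  conv_lhs => rw [← b.sum_repr' (v i), ← b.sum_repr' (v j)]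
  simp only [map_sum, map_smul, mul_apply, transpose_apply, of_apply, Finset.sum_mul,
    _root_.sum_apply, _root_.smul_apply, smul_eq_mul]
  refine Finset.sum_congr rfl fun m _ => ?_
  rw [Finset.mul_sum]
  refine Finset.sum_congr rfl fun k _ => ?_
  ring

theorem graphMetric_congruence (b : OrthonormalBasis (Fin n) ℝ E) (φ : E → ℝ) (y : E)
    (v : Fin n → E) :
    (of fun i j => inner ℝ (v i) (v j) + fderiv ℝ φ y (v i) * fderiv ℝ φ y (v j)) =
      (of fun k i => inner ℝ (b k) (v i))ᵀ * graphMetric b φ y *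
        (of fun k i => inner ℝ (b k) (v i)) := by
  let I : E →L[ℝ] E →L[ℝ] ℝ := innerSL ℝ
  have h := gram_eq_congruence b (I + (fderiv ℝ φ y).smulRight (fderiv ℝ φ y)) v
  have g : graphMetric b φ y =
      of fun k m => (I + (fderiv ℝ φ y).smulRight (fderiv ℝ φ y)) (b k) (b m) := by
    ext k m
    exact congrArg (· + _) (orthonormal_iff_ite.1 b.orthonormal k m).symm
  rw [g, ← h]
  rfl

theorem graphHessian_congruence (b : OrthonormalBasis (Fin n) ℝ E) {φ : E → ℝ}
    (hφ : ContDiff ℝ 2 φ) (s : ℝ) (y : E) (v : Fin n → E) :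
    (of fun i j => s * fderiv ℝ (fderiv ℝ φ) y (v i) (v j)) =
      (of fun k i => inner ℝ (b k) (v i))ᵀ * (s • graphHessian b φ y) *
        (of fun k i => inner ℝ (b k) (v i)) := by
  have h := gram_eq_congruence b (s • fderiv ℝ (fderiv ℝ φ) y) v
  have g : s • graphHessian b φ y = of fun k m => (s • fderiv ℝ (fderiv ℝ φ) y) (b k) (b m) := by
    ext k m
    change s * dirDeriv (b m) (dirDeriv (b k) φ) y = s * fderiv ℝ (fderiv ℝ φ) y (b k) (b m)
    rw [dirDeriv_comm hφ, dirDeriv_dirDeriv hφ]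
  rw [g, ← h]
  rfl

theorem fderiv_apply_self_eq_sum (b : OrthonormalBasis (Fin n) ℝ E) (φ : E → ℝ) (y w : E) :
    fderiv ℝ φ y w = ∑ k, inner ℝ (b k) w * dirDeriv (b k) φ y := by
  conv_lhs => rw [← b.sum_repr' w]
  simp [dirDeriv]

end GraphForms

section Manifold

open GaussShrinker

variable {n : ℕ} {M : Type*} [TopologicalSpace M] [ChartedSpace (EuclideanSpace ℝ (Fin n)) M]
  {F N : M → EuclideanSpace ℝ (Fin (n + 1))}

/-- The geometry of an immersion near a point in terms of a local representation as a graph. -/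
theorem eventually_forms_eq [IsManifold (𝓡 n) ∞ M] (hn : 0 < n)
    (hF : ContMDiff (𝓡 n) (𝓡 (n + 1)) ∞ F)
    (hFimm : ∀ p, Function.Injective (mfderiv (𝓡 n) (𝓡 (n + 1)) F p))
    (hN1 : ∀ p, ‖N p‖ = 1)
    (hN : ∀ p v, inner ℝ
      (fderiv ℝ (F ∘ (extChartAt (𝓡 n) p).symm) (extChartAt (𝓡 n) p p) v) (N p) = 0)
    (hconv : ∀ p, (secondFundamentalForm F N p).PosDef) {q : M}
    {π : EuclideanSpace ℝ (Fin (n + 1)) →L[ℝ] EuclideanSpace ℝ (Fin n)}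
    (hπ : IsProjectionAlong π (N q)) {φ : EuclideanSpace ℝ (Fin n) → ℝ} (hφ : ContDiff ℝ 4 φ)
    (hgraph : ∀ᶠ p in 𝓝 q, inner ℝ (F p) (N q) = φ (π (F p)))
    (b : OrthonormalBasis (Fin n) ℝ (EuclideanSpace ℝ (Fin n))) :
    ∀ᶠ p in 𝓝 q, ∃ (s : ℝ) (J : Matrix (Fin n) (Fin n) ℝ), 0 < s ∧ IsUnit J.det ∧
      s ^ 2 * (1 + ∑ k, dirDeriv (b k) φ (π (F p)) ^ 2) = 1 ∧
      -inner ℝ (F p) (N p) =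
        s * (∑ k, inner ℝ (b k) (π (F p)) * dirDeriv (b k) φ (π (F p)) - φ (π (F p))) ∧
      metric F p = Jᵀ * graphMetric b φ (π (F p)) * J ∧
      secondFundamentalForm F N p = Jᵀ * (s • graphHessian b φ (π (F p))) * J ∧
      (s • graphHessian b φ (π (F p))).PosDef ∧ s = inner ℝ (N p) (N q) := by
  have hφ2 : ContDiff ℝ 2 φ := hφ.of_le (by norm_num)
  have main : ∀ᶠ p in 𝓝 q, ∃ J : Matrix (Fin n) (Fin n) ℝ, IsUnit J.det ∧
      inner ℝ (N p) (N q) ^ 2 * (1 + ∑ k, dirDeriv (b k) φ (π (F p)) ^ 2) = 1 ∧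
      -inner ℝ (F p) (N p) = inner ℝ (N p) (N q) *
        (∑ k, inner ℝ (b k) (π (F p)) * dirDeriv (b k) φ (π (F p)) - φ (π (F p))) ∧
      metric F p = Jᵀ * graphMetric b φ (π (F p)) * J ∧
      secondFundamentalForm F N p =
        Jᵀ * ((inner ℝ (N p) (N q) : ℝ) • graphHessian b φ (π (F p))) * J ∧
      ((inner ℝ (N p) (N q) : ℝ) • graphHessian b φ (π (F p))).PosDef := by
    filter_upwards [hgraph.eventually_nhds] with p hp
    set X := F ∘ (extChartAt (𝓡 n) p).symm with hXdef
    set x := extChartAt (𝓡 n) p p with hx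
    have hX : ContDiffAt ℝ 2 X x := (contDiffAt_comp_extChartAt_symm hF p).of_le
      (WithTop.coe_le_coe.2 (le_top : (2 : ℕ∞) ≤ ⊤))
    have hXx : X x = F p := by simp [hXdef, hx]
    have hinj : Function.Injective (fderiv ℝ X x) := by
      rw [← mfderiv_eq_fderiv_extChartAt hF p]; exact hFimm p
    have hXg : ∀ᶠ z in 𝓝 x, inner ℝ (X z) (N q) = φ (π (X z)) :=
      (tendsto_extChartAt_symm p).eventually hp
    have h1 := firstForm_of_graph hπ hX hφ2 hXg
    have h2 := secondForm_of_graph hπ hX hφ2 hXg hinj (hN p)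
    have h3 := norm_normal_of_graph hπ hX hφ2 hXg hinj (hN p) (hN1 p) b
    have h4 := support_of_graph hπ hX hφ2 hXg hinj (hN p)
    rw [hXx] at h1 h2 h3 h4
    set y := π (F p)
    set v : Fin n → EuclideanSpace ℝ (Fin n) := fun i =>
      π (fderiv ℝ X x (EuclideanSpace.single i 1)) with hv
    set J : Matrix (Fin n) (Fin n) ℝ := of fun k i => inner ℝ (b k) (v i) with hJ
    have e1 : metric F p = Jᵀ * graphMetric b φ y * J := by
      rw [hJ, ← graphMetric_congruence]
      ext i j
      exact h1 _ _
    have e2 : secondFundamentalForm F N p =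
        Jᵀ * ((inner ℝ (N p) (N q) : ℝ) • graphHessian b φ y) * J := by
      rw [hJ, ← graphHessian_congruence b hφ2]
      ext i j
      exact h2 _ _
    have hJu : IsUnit J.det := by
      have h5 := (hconv p).det_pos.ne'
      rw [e2, det_mul] at h5
      exact isUnit_iff_ne_zero.2 (right_ne_zero_of_mul h5)
    refine ⟨J, hJu, h3, ?_, e1, e2, ?_⟩
    · rw [h4, fderiv_apply_self_eq_sum b]
    · have h5 := hconv p
      rw [e2, ← conjTranspose_eq_transpose_of_trivial, ← star_eq_conjTranspose] at h5
      exact (IsUnit.posDef_star_left_conjugate_iff ((isUnit_iff_isUnit_det J).2 hJu)).1 h5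
  -- The sign of s = ⟨N p, N q⟩ is found without continuity of `N`: s times a diagonal Hessian entry
  -- is positive near q, and that entry is positive at q, where s = 1, hence also nearby.
  have hpos : ∀ᶠ p in 𝓝 q, 0 < graphHessian b φ (π (F p)) ⟨0, hn⟩ ⟨0, hn⟩ := by
    obtain ⟨J, _, _, _, _, _, h⟩ := main.self_of_nhds
    rw [real_inner_self_eq_norm_sq, hN1, one_pow, one_smul] at h
    have hc : Continuous fun p => graphHessian b φ (π (F p)) ⟨0, hn⟩ ⟨0, hn⟩ := by
      have : Continuous (dirDeriv (b ⟨0, hn⟩) (dirDeriv (b ⟨0, hn⟩) φ)) :=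
        ((hφ.dirDeriv (m := 3) (by norm_num) _).dirDeriv (m := 2) (by norm_num) _).continuous
      exact this.comp (π.continuous.comp hF.continuous)
    exact hc.continuousAt.eventually (lt_mem_nhds h.diag_pos)
  filter_upwards [main, hpos] with p ⟨J, h1, h2, h3, h4, h5, h6⟩ hp
  refine ⟨_, J, ?_, h1, h2, h3, h4, h5, h6, rfl⟩
  have h7 := h6.diag_pos (i := ⟨0, hn⟩)
  rw [Matrix.smul_apply, smul_eq_mul] at h7
  exact (pos_iff_pos_of_mul_pos h7).2 hp

end Manifold

section GraphForms

variable {n : ℕ} {E : Type*} [NormedAddCommGroup E] [InnerProductSpace ℝ E]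

theorem det_graphMetric (b : OrthonormalBasis (Fin n) ℝ E) (φ : E → ℝ) (y : E) :
    (graphMetric b φ y).det = 1 + ∑ k, dirDeriv (b k) φ y ^ 2 := by
  have h : graphMetric b φ y = 1 + replicateCol Unit (fun k => dirDeriv (b k) φ y) *
      replicateRow Unit fun k => dirDeriv (b k) φ y := by
    ext k m
    simp [graphMetric, mul_apply, one_apply]
  rw [h, det_one_add_replicateCol_mul_replicateRow]
  simp [dotProduct, sq]

theorem dotProduct_graphMetric_mulVec (b : OrthonormalBasis (Fin n) ℝ E) (φ : E → ℝ) (y : E)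
    (c : Fin n → ℝ) : c ⬝ᵥ graphMetric b φ y *ᵥ c =
      ∑ k, c k ^ 2 + (∑ k, c k * dirDeriv (b k) φ y) ^ 2 := by
  have h : graphMetric b φ y = 1 + vecMulVec (fun k => dirDeriv (b k) φ y)
      fun k => dirDeriv (b k) φ y := by
    ext k m
    simp [graphMetric, vecMulVec_apply, one_apply]
  rw [h, add_mulVec, dotProduct_add, one_mulVec, vecMulVec_mulVec, dotProduct_smul]
  simp only [dotProduct, MulOpposite.smul_eq_mul_unop, MulOpposite.unop_op, sq]
  simp only [mul_comm (dirDeriv _ _ _)]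

theorem dotProduct_graphHessian_mulVec (b : OrthonormalBasis (Fin n) ℝ E) (φ : E → ℝ) (y : E)
    (c : Fin n → ℝ) : c ⬝ᵥ graphHessian b φ y *ᵥ c =
      ∑ k, ∑ m, c k * c m * dirDeriv (b m) (dirDeriv (b k) φ) y := by
  simp only [dotProduct, mulVec, graphHessian, of_apply, Finset.mul_sum]
  exact Finset.sum_congr rfl fun k _ => Finset.sum_congr rfl fun m _ => by ring

/-- The Hessian of a function has an orthonormal eigenbasis. -/
theorem exists_hessian_eigenbasis [FiniteDimensional ℝ E] (hn : Module.finrank ℝ E = n) {φ : E → ℝ}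
    (hφ : ContDiff ℝ 2 φ) (y : E) : ∃ (b : OrthonormalBasis (Fin n) ℝ E) (l : Fin n → ℝ),
      graphHessian b φ y = diagonal l := by
  have := FiniteDimensional.complete ℝ E
  let T : E →ₗ[ℝ] E :=
    { toFun := fun v => (InnerProductSpace.toDual ℝ E).symm (fderiv ℝ (fderiv ℝ φ) y v)
      map_add' := by simp
      map_smul' := by simp }
  have hT : ∀ v w, inner ℝ (T v) w = fderiv ℝ (fderiv ℝ φ) y v w := fun v w =>
    InnerProductSpace.toDual_symm_apply
  have hs : T.IsSymmetric := fun v w => by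
    rw [hT, real_inner_comm, hT]
    exact (hφ.contDiffAt (x := y)).isSymmSndFDerivAt (by simp) v w
  refine ⟨hs.eigenvectorBasis hn, hs.eigenvalues hn, ?_⟩
  ext i j
  rw [graphHessian, of_apply, dirDeriv_comm hφ, dirDeriv_dirDeriv hφ, ← hT,
    hs.apply_eigenvectorBasis, diagonal_apply]
  simp [inner_smul_left, orthonormal_iff_ite.1 (hs.eigenvectorBasis hn).orthonormal i j]

end GraphForms

section LinearAlgebra

variable {n : ℕ} {g h : Matrix (Fin n) (Fin n) ℝ}

theorem dotProduct_le_sSup_rayleighSet_mul (hn : 0 < n) (hg : g.PosDef) (hh : h.PosDef)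
    (v : Fin n → ℝ) : v ⬝ᵥ g *ᵥ v ≤ sSup (rayleighSet g h) * (v ⬝ᵥ h *ᵥ v) := by
  rcases eq_or_ne v 0 with rfl | hv
  · simp
  have h1 : 0 < v ⬝ᵥ h *ᵥ v := by simpa using hh.dotProduct_mulVec_pos hv
  have h2 := (isGreatest_sSup_rayleighSet hn hg hh).2 (show (v ⬝ᵥ g *ᵥ v) / (v ⬝ᵥ h *ᵥ v) ∈ _ from
    ⟨v, hv, by rw [div_mul_cancel₀ _ h1.ne']⟩)
  rwa [div_le_iff₀ h1] at h2

theorem exists_norm_eq_one_rayleigh (hn : 0 < n) (hg : g.PosDef) (hh : h.PosDef) :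
    ∃ v : Fin n → ℝ, ‖v‖ = 1 ∧ v ⬝ᵥ g *ᵥ v = sSup (rayleighSet g h) * (v ⬝ᵥ h *ᵥ v) := by
  obtain ⟨v, hv, h1⟩ := (isGreatest_sSup_rayleighSet hn hg hh).1
  refine ⟨‖v‖⁻¹ • v, by rw [norm_smul, norm_inv, norm_norm, inv_mul_cancel₀ (norm_ne_zero_iff.2 hv)],
    ?_⟩
  simp only [mulVec_smul, dotProduct_smul, smul_dotProduct, smul_eq_mul, h1]
  ring

end LinearAlgebra

/-! ### Upper semicontinuity of the comparison function -/

section Manifold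

open GaussShrinker

variable {n : ℕ} {M : Type*} [TopologicalSpace M] [ChartedSpace (EuclideanSpace ℝ (Fin n)) M]
  {F N : M → EuclideanSpace ℝ (Fin (n + 1))}

theorem metric_posDef [IsManifold (𝓡 n) ∞ M] (hF : ContMDiff (𝓡 n) (𝓡 (n + 1)) ∞ F)
    (hFimm : ∀ p, Function.Injective (mfderiv (𝓡 n) (𝓡 (n + 1)) F p)) (p : M) :
    (metric F p).PosDef := by
  have hinj := hFimm p
  rw [mfderiv_eq_fderiv_extChartAt hF p] at hinj
  refine posDef_gram_of_linearIndependent (𝕜 := ℝ) (v := fun i =>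
    fderiv ℝ (F ∘ (extChartAt (𝓡 n) p).symm) (extChartAt (𝓡 n) p p) (EuclideanSpace.single i 1)) ?_
  have h := (EuclideanSpace.basisFun (Fin n) ℝ).toBasis.linearIndependent
  simpa [Function.comp_def] using h.map' (fderiv ℝ (F ∘ (extChartAt (𝓡 n) p).symm)
    (extChartAt (𝓡 n) p p)).toLinearMap (LinearMap.ker_eq_bot.2 hinj)

/-- The largest principal radius of curvature `λ_min⁻¹`. -/
noncomputable def maxRadius (F N : M → EuclideanSpace ℝ (Fin (n + 1))) (p : M) : ℝ :=
  sSup (rayleighSet (metric F p) (secondFundamentalForm F N p))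

/-- The function `-⟨F, N⟩ λ_min⁻¹ - γ / 2 |F|²`. -/
noncomputable def radiusFun (γ : ℝ) (F N : M → EuclideanSpace ℝ (Fin (n + 1))) (p : M) : ℝ :=
  -inner ℝ (F p) (N p) * maxRadius F N p - γ / 2 * ‖F p‖ ^ 2

/-- Locally the function is a maximum, over the compact unit sphere of directions, of functions
jointly continuous in point and direction; compactness makes strict upper bounds persist nearby. -/
theorem upperSemicontinuous_radiusFun [IsManifold (𝓡 n) ∞ M] (hn : 0 < n) (γ : ℝ)
    (hF : ContMDiff (𝓡 n) (𝓡 (n + 1)) ∞ F)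
    (hFimm : ∀ p, Function.Injective (mfderiv (𝓡 n) (𝓡 (n + 1)) F p))
    (hN1 : ∀ p, ‖N p‖ = 1)
    (hN : ∀ p v, inner ℝ
      (fderiv ℝ (F ∘ (extChartAt (𝓡 n) p).symm) (extChartAt (𝓡 n) p p) v) (N p) = 0)
    (hconv : ∀ p, (secondFundamentalForm F N p).PosDef)
    (hpos : ∀ p, 0 < -inner ℝ (F p) (N p)) :
    UpperSemicontinuous (radiusFun γ F N) := by
  rw [upperSemicontinuous_iff]
  intro q
  rw [upperSemicontinuousAt_iff]
  intro c hc
  obtain ⟨π, hπ⟩ := exists_isProjectionAlong (hN1 q)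
  obtain ⟨φ, hφ, hgraph, -⟩ := exists_graph hF hFimm (hN q) hπ
  let b := EuclideanSpace.basisFun (Fin n) ℝ
  have hforms := eventually_forms_eq hn hF hFimm hN1 hN hconv hπ hφ hgraph b
  let U : M → ℝ := fun p =>
    ∑ k, inner ℝ (b k) (π (F p)) * dirDeriv (b k) φ (π (F p)) - φ (π (F p))
  let G : M → (Fin n → ℝ) → ℝ := fun p v =>
    ∑ k, v k ^ 2 + (∑ k, v k * dirDeriv (b k) φ (π (F p))) ^ 2
  let H : M → (Fin n → ℝ) → ℝ := fun p v =>
    ∑ k, ∑ m, v k * v m * dirDeriv (b m) (dirDeriv (b k) φ) (π (F p))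
  have hFc := hF.continuous
  have hπF : Continuous fun p => π (F p) := π.continuous.comp hFc
  have hφ0 : Continuous fun p => φ (π (F p)) := hφ.continuous.comp hπF
  have hφ1 : ∀ k, Continuous fun p => dirDeriv (b k) φ (π (F p)) := fun k =>
    (hφ.dirDeriv (m := 3) (by norm_num) _).continuous.comp hπF
  have hφ2 : ∀ k m, Continuous fun p => dirDeriv (b m) (dirDeriv (b k) φ) (π (F p)) := fun k m =>
    ((hφ.dirDeriv (m := 3) (by norm_num) _).dirDeriv (m := 2) (by norm_num) _).continuous.comp hπF
  have hU : Continuous U := by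
    refine (continuous_finsetSum _ fun k _ => ?_).sub hφ0
    exact (continuous_const.inner hπF).mul (hφ1 k)
  have hG : Continuous fun z : M × (Fin n → ℝ) => G z.1 z.2 := by
    have := fun k => (hφ1 k).comp (continuous_fst (X := M) (Y := Fin n → ℝ))
    simp only [Function.comp_def] at this
    fun_prop
  have hH : Continuous fun z : M × (Fin n → ℝ) => H z.1 z.2 := by
    have := fun k m => (hφ2 k m).comp (continuous_fst (X := M) (Y := Fin n → ℝ))
    simp only [Function.comp_def] at this
    fun_prop
  -- The support function is s U and the second form is s H, so s cancels and only continuous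
  -- expressions in φ and F remain.
  have hval : ∀ᶠ p in 𝓝 q, (∀ v, v ≠ 0 → 0 < H p v) ∧ 0 < U p ∧
      (∀ v, v ≠ 0 → U p * (G p v / H p v) ≤ -inner ℝ (F p) (N p) * maxRadius F N p) ∧
      ∃ v : Fin n → ℝ, ‖v‖ = 1 ∧ U p * (G p v / H p v) = -inner ℝ (F p) (N p) * maxRadius F N p := by
    filter_upwards [hforms] with p ⟨s, J, hs, hJ, h1, h2, h3, h4, h5, _⟩
    have e1 : maxRadius F N p =
        sSup (rayleighSet (graphMetric b φ (π (F p))) (s • graphHessian b φ (π (F p)))) := by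
      rw [maxRadius, h3, h4, rayleighSet_congruence hJ]
    have hg : (graphMetric b φ (π (F p))).PosDef := by
      have := metric_posDef hF hFimm p
      rw [h3, ← conjTranspose_eq_transpose_of_trivial, ← star_eq_conjTranspose] at this
      exact (IsUnit.posDef_star_left_conjugate_iff ((isUnit_iff_isUnit_det J).2 hJ)).1 this
    have hHpos : ∀ v, v ≠ 0 → 0 < H p v := fun v hv => by
      have := h5.dotProduct_mulVec_pos hv
      rw [smul_mulVec, dotProduct_smul, smul_eq_mul, star_trivial,
        dotProduct_graphHessian_mulVec] at this
      exact (pos_iff_pos_of_mul_pos this).1 hs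
    have hUpos : 0 < U p := by
      have := hpos p
      rw [h2] at this
      exact (pos_iff_pos_of_mul_pos this).1 hs
    have hdot : ∀ v, v ⬝ᵥ (s • graphHessian b φ (π (F p))) *ᵥ v = s * H p v := fun v => by
      rw [smul_mulVec, dotProduct_smul, smul_eq_mul, dotProduct_graphHessian_mulVec]
    refine ⟨hHpos, hUpos, fun v hv => ?_, ?_⟩
    · have := dotProduct_le_sSup_rayleighSet_mul hn hg h5 v
      rw [← e1, hdot, dotProduct_graphMetric_mulVec] at this
      have hv' := hHpos v hv
      rw [h2, mul_comm s, mul_assoc]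
      refine mul_le_mul_of_nonneg_left ?_ hUpos.le
      rw [div_le_iff₀ hv']
      refine this.trans (le_of_eq (by ring))
    · obtain ⟨v, hv, h6⟩ := exists_norm_eq_one_rayleigh hn hg h5
      refine ⟨v, hv, ?_⟩
      rw [← e1, hdot, dotProduct_graphMetric_mulVec] at h6
      have hv' := hHpos v (fun h => by simp [h] at hv)
      have h7 : G p v / H p v = s * maxRadius F N p := by
        rw [div_eq_iff hv'.ne']
        exact h6.trans (by ring)
      rw [h7, h2]
      ring
  have hK := (isCompact_sphere (0 : Fin n → ℝ) 1).eventually_forall_of_forall_eventually (x₀ := q)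
    (P := fun p v => U p * (G p v / H p v) - γ / 2 * ‖F p‖ ^ 2 < c) ?_
  · filter_upwards [hval, hK] with p ⟨_, _, _, v, hv, h1⟩ h2
    rw [radiusFun, ← h1]
    exact h2 v (by simpa using hv)
  · intro v hv
    obtain ⟨h1, h2, h3, -⟩ := hval.self_of_nhds
    have hv0 : v ≠ 0 := fun h => by simp [h] at hv
    have hc' : ContinuousAt (fun z : M × (Fin n → ℝ) =>
        U z.1 * (G z.1 z.2 / H z.1 z.2) - γ / 2 * ‖F z.1‖ ^ 2) (q, v) := by
      refine ContinuousAt.sub ?_ ?_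
      · exact (hU.comp continuous_fst).continuousAt.mul
          (hG.continuousAt.div hH.continuousAt (h1 v hv0).ne')
      · exact (continuous_const.mul ((hFc.comp continuous_fst).norm.pow 2)).continuousAt
    refine hc'.eventually_lt continuousAt_const ?_
    refine lt_of_le_of_lt ?_ hc
    exact sub_le_sub_right (h3 v hv0) _

end Manifold

/-! ### Maximum points of the comparison function -/

section Manifold

open GaussShrinker

variable {n : ℕ} {M : Type*} [TopologicalSpace M] [ChartedSpace (EuclideanSpace ℝ (Fin n)) M]
  {F N : M → EuclideanSpace ℝ (Fin (n + 1))}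

/-- The logarithmic form of the equation `K ^ α = s E` for a graph with `K = sⁿ D / ψ`, where
`s = ψ ^ (-1 / 2)`. -/
theorem log_equation_of_rpow {α s ψ D e : ℝ} (hα : 0 < α) (hs : 0 < s) (hψ : 0 < ψ) (hD : 0 < D)
    (he : 0 < e) (hsψ : s ^ 2 * ψ = 1) (h : (s ^ n * D / ψ) ^ α = s * e) :
    Real.log D = 1 / α * Real.log e + (n + 2 - 1 / α) / 2 * Real.log ψ := by
  have h1 : 2 * Real.log s + Real.log ψ = 0 := by
    have := congrArg Real.log hsψ
    rwa [Real.log_mul (by positivity) hψ.ne', Real.log_pow, Real.log_one, Nat.cast_ofNat] at this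
  have h2 := congrArg Real.log h
  rw [Real.log_rpow (by positivity), Real.log_mul hs.ne' he.ne', Real.log_div (by positivity) hψ.ne',
    Real.log_mul (by positivity) hD.ne', Real.log_pow] at h2
  have h3 : Real.log s = -Real.log ψ / 2 := by linarith
  rw [h3] at h2
  field_simp
  linarith

/-- A maximum point of `-⟨F, N⟩ λ_min⁻¹ - γ / 2 |F|²` on a shrinker is umbilical, and the position
vector is normal there. -/
theorem isUmbilical_of_isMax_radiusFun [IsManifold (𝓡 n) ∞ M] (hn : 2 ≤ n) {α γ : ℝ} (hγ : 0 < γ)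
    (hα : 0 < α) (hα2 : α < 2) (hαγ : 1 / α = n * (1 - γ))
    (hF : ContMDiff (𝓡 n) (𝓡 (n + 1)) ∞ F)
    (hFimm : ∀ p, Function.Injective (mfderiv (𝓡 n) (𝓡 (n + 1)) F p))
    (hN1 : ∀ p, ‖N p‖ = 1)
    (hN : ∀ p v, inner ℝ
      (fderiv ℝ (F ∘ (extChartAt (𝓡 n) p).symm) (extChartAt (𝓡 n) p p) v) (N p) = 0)
    (hconv : ∀ p, (secondFundamentalForm F N p).PosDef)
    (hpos : ∀ p, 0 < -inner ℝ (F p) (N p))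
    (hsol : ∀ p, ((secondFundamentalForm F N p).det / (metric F p).det) ^ α = -inner ℝ (F p) (N p))
    {q : M} (hmax : ∀ p, radiusFun γ F N p ≤ radiusFun γ F N q) :
    IsUmbilical F N q ∧ ∀ z, inner ℝ z (N q) = 0 → inner ℝ (F q) z = 0 := by
  have hn0 : 0 < n := by omega
  have hγ1 : γ < 1 := by
    have h1 : 0 < 1 / α := by positivity
    rw [hαγ] at h1
    have := (pos_iff_pos_of_mul_pos h1).1 (by exact_mod_cast hn0)
    linarith
  obtain ⟨π, hπ⟩ := exists_isProjectionAlong (hN1 q)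
  obtain ⟨φ, hφ, hgraph, σ, hσ, hσ'⟩ := exists_graph hF hFimm (hN q) hπ
  set y₀ := π (F q) with hy₀
  obtain ⟨b, l, hHess⟩ := exists_hessian_eigenbasis (n := n) (by simp) (hφ.of_le (by norm_num)) y₀
  have hforms := eventually_forms_eq hn0 hF hFimm hN1 hN hconv hπ hφ hgraph b
  obtain ⟨s, J, hs, hJ, h1, h2, h3, h4, h5, h6⟩ := hforms.self_of_nhds
  rw [real_inner_self_eq_norm_sq, hN1, one_pow] at h6
  subst h6
  rw [← hy₀, one_smul, hHess] at h4 h5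
  rw [← hy₀] at h1 h2 h3
  have hl : ∀ i, 0 < l i := posDef_diagonal_iff.1 h5
  have : Nonempty (Fin n) := ⟨⟨0, hn0⟩⟩
  obtain ⟨o, ho⟩ := Finite.exists_min l
  -- At q one has s = ‖N q‖² = 1, so s²(1+|∇φ|²) = 1 forces the gradient to vanish.
  have h0 : ∀ k, dirDeriv (b k) φ y₀ = 0 := by
    have : ∑ k, dirDeriv (b k) φ y₀ ^ 2 = 0 := by linarith
    exact fun k => pow_eq_zero_iff two_ne_zero |>.1
      ((Finset.sum_eq_zero_iff_of_nonneg fun _ _ => sq_nonneg _).1 this k (Finset.mem_univ k))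
  have hG1 : graphMetric b φ y₀ = 1 := by
    ext k m
    simp [graphMetric, h0, one_apply]
  rw [hG1] at h3
  have hu : φ y₀ < 0 := by
    have := hpos q
    rw [h2] at this
    simp only [h0, mul_zero, Finset.sum_const_zero, zero_sub, one_mul] at this
    linarith
  have hsupp : -inner ℝ (F q) (N q) = -φ y₀ := by rw [h2]; simp [h0]
  have hnorm : ∀ᶠ p in 𝓝 q, ‖F p‖ ^ 2 = ∑ k, inner ℝ (b k) (π (F p)) ^ 2 + φ (π (F p)) ^ 2 := by
    filter_upwards [hgraph] with p hp
    rw [← real_inner_self_eq_norm_sq, hπ, hp, real_inner_self_eq_norm_sq,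
      ← b.sum_sq_norm_inner_right]
    simp [sq]
  have hnorm0 := hnorm.self_of_nhds
  rw [← hy₀] at hnorm0
  set W := radiusFun γ F N q with hW
  have hrad : maxRadius F N q = 1 / l o := by
    rw [maxRadius, h3, h4, rayleighSet_congruence hJ, (isGreatest_rayleighSet_diagonal hl ho).csSup_eq]
  have key := umbilic_of_max_of_graph hn hγ hγ1 hαγ
    (by rw [div_lt_div_iff₀ two_pos hα]; linarith) b hφ hl ho h0
    (fun i j => by
      have := congrFun (congrFun hHess i) j
      rwa [diagonal_apply] at this) hu (W := W) ?_ ?_ ?_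
  · have hy : y₀ = 0 := by
      rw [← b.sum_repr' y₀]
      exact Finset.sum_eq_zero fun i _ => by rw [(key i).2, zero_smul]
    refine ⟨⟨l o, ?_⟩, fun z hz => ?_⟩
    · have : diagonal l = l o • (1 : Matrix (Fin n) (Fin n) ℝ) := by
        rw [smul_one_eq_diagonal]
        congr 1
        exact funext fun i => (key i).1
      rw [h4, h3, this, mul_smul_comm, smul_mul_assoc]
    · rw [hπ, ← hy₀, hy, inner_zero_left, hz, mul_zero, add_zero]
  · rw [← hnorm0, hW, radiusFun, hrad, hsupp]
    have := (hl o).ne'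
    field_simp
    ring
  · filter_upwards [hσ.eventually hforms, hσ'] with y ⟨s, J, hs, hJ, k1, k2, k3, k4, k5, _⟩ hy
    rw [hy] at k1 k2 k3 k4 k5
    have hψ : 0 < 1 + ∑ k, dirDeriv (b k) φ y ^ 2 := by positivity
    have hE := hpos (σ y)
    rw [k2] at hE
    have hE' := (pos_iff_pos_of_mul_pos hE).1 hs
    have hD : 0 < (graphHessian b φ y).det := by
      have := k5.det_pos
      rw [det_smul, Fintype.card_fin] at this
      exact (pos_iff_pos_of_mul_pos this).1 (by positivity)
    refine log_equation_of_rpow hα hs hψ hD hE' k1 ?_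
    rw [← k2, ← hsol, k3, k4]
    congr 1
    have hJ' : J.det ≠ 0 := hJ.ne_zero
    simp only [det_mul, det_transpose, det_smul, Fintype.card_fin, det_graphMetric]
    field_simp
    rfl
  -- Bound the Rayleigh quotient by the maximal radius, then use the global bound by W; the factor s
  -- of the support function matches that of the second form.
  · filter_upwards [hσ.eventually hforms, hσ', hσ.eventually hnorm] with y
      ⟨s, J, hs, hJ, k1, k2, k3, k4, k5, _⟩ hy k6 c
    rw [hy] at k1 k2 k3 k4 k5 k6
    have hE := hpos (σ y)
    have k7 := hmax (σ y)
    have hg : (graphMetric b φ y).PosDef := by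
      have := metric_posDef hF hFimm (σ y)
      rw [k3, ← conjTranspose_eq_transpose_of_trivial, ← star_eq_conjTranspose] at this
      exact (IsUnit.posDef_star_left_conjugate_iff ((isUnit_iff_isUnit_det J).2 hJ)).1 this
    have k8 := dotProduct_le_sSup_rayleighSet_mul hn0 hg k5 c
    rw [← rayleighSet_congruence hJ, ← k3, ← k4, dotProduct_graphMetric_mulVec, smul_mulVec,
      dotProduct_smul, smul_eq_mul, dotProduct_graphHessian_mulVec] at k8
    have k9 : 0 ≤ ∑ k, ∑ m, c k * c m * dirDeriv (b m) (dirDeriv (b k) φ) y := by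
      have := k5.posSemidef.dotProduct_mulVec_nonneg c
      rw [smul_mulVec, dotProduct_smul, smul_eq_mul, star_trivial,
        dotProduct_graphHessian_mulVec] at this
      exact nonneg_of_mul_nonneg_right this hs
    change -inner ℝ (F (σ y)) (N (σ y)) * sSup _ - γ / 2 * ‖F (σ y)‖ ^ 2 ≤ W at k7
    rw [k2] at k7 hE
    rw [k6] at k7
    have hE' := (pos_iff_pos_of_mul_pos hE).1 hs
    refine (mul_le_mul_of_nonneg_left k8 hE'.le).trans ?_
    refine le_trans (le_of_eq ?_) (mul_le_mul_of_nonneg_right (sub_le_iff_le_add'.1 k7) k9)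
    ring

end Manifold

section Manifold

variable {n : ℕ} {M : Type*} [TopologicalSpace M] [ChartedSpace (EuclideanSpace ℝ (Fin n)) M]
  {F N : M → EuclideanSpace ℝ (Fin (n + 1))}

theorem mfderiv_norm_sq_eq_zero [IsManifold (𝓡 n) ∞ M]
    (hF : ContMDiff (𝓡 n) (𝓡 (n + 1)) ∞ F) {p : M}
    (h : ∀ v, inner ℝ (F p)
      (fderiv ℝ (F ∘ (extChartAt (𝓡 n) p).symm) (extChartAt (𝓡 n) p p) v) = 0) :
    mfderiv (𝓡 n) 𝓘(ℝ, ℝ) (fun p => ‖F p‖ ^ 2) p = 0 := by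
  have hFd := (hF p).mdifferentiableAt (by simp)
  have h1 : HasMFDerivAt (𝓡 (n + 1)) 𝓘(ℝ, ℝ) (fun z : EuclideanSpace ℝ (Fin (n + 1)) => ‖z‖ ^ 2)
      (F p) (2 • innerSL ℝ (F p)) := (hasStrictFDerivAt_norm_sq (F p)).hasFDerivAt.hasMFDerivAt
  have h2 := (h1.comp p hFd.hasMFDerivAt).mfderiv
  refine h2.trans ?_
  rw [mfderiv_eq_fderiv_extChartAt hF p]
  refine ContinuousLinearMap.ext fun v => ?_
  change (2 • innerSL ℝ (F p)) (fderiv ℝ _ _ v) = 0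
  exact (congrArg (fun r : ℝ => 2 • r) (h v)).trans (smul_zero _)

end Manifold

end ShrinkerMaximumPrinciple

/-! ### From the comparison function back to f -/

theorem proposition4p1 {n : ℕ} (hn : 2 ≤ n) {α : ℝ}
    (hα₁ : 1 / (n : ℝ) < α) (hα₂ : α < 1 + 1 / (n : ℝ))
    {M : Type*} [TopologicalSpace M] [T2Space M] [CompactSpace M]
    [ChartedSpace (EuclideanSpace ℝ (Fin n)) M] [IsManifold (𝓡 n) ∞ M]
    -- `S` is a closed convex hypersurface
    (S : Set (EuclideanSpace ℝ (Fin (n + 1))))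
    (hS : GaussShrinker.IsClosedConvexHypersurface S)
    -- `F` is a smooth immersion of `M` with image `S`
    (F : M → EuclideanSpace ℝ (Fin (n + 1)))
    (hF : ContMDiff (𝓡 n) (𝓡 (n + 1)) ∞ F)
    (hFimm : ∀ p, Function.Injective (mfderiv (𝓡 n) (𝓡 (n + 1)) F p))
    (hFS : Set.range F = S)
    -- `N` is the interior unit normal
    (N : M → EuclideanSpace ℝ (Fin (n + 1)))
    (hN : ∀ p, GaussShrinker.IsInteriorUnitNormal S F p (N p))
    -- strict convexity: the second fundamental form is positive definite
    (hconv : ∀ p, (GaussShrinker.secondFundamentalForm F N p).PosDef)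
    -- the shrinker equation
    (hsol : ∀ p, GaussShrinker.gaussCurvature F N p ^ α = -inner ℝ (F p) (N p))
    -- `f` attains its maximum at `p₀`
    (p₀ : M) (hmax : ∀ p, GaussShrinker.fFun α F N p ≤ GaussShrinker.fFun α F N p₀) :
    GaussShrinker.IsUmbilical F N p₀ ∧
      mfderiv (𝓡 n) 𝓘(ℝ, ℝ) (fun p => ‖F p‖ ^ 2) p₀ = 0 := by

  have hn0 : 0 < n := by omega
  have hnR : (2 : ℝ) ≤ n := by exact_mod_cast hn
  have hα : 0 < α := lt_trans (by positivity) hα₁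
  have hnα : 1 < n * α := by
    rw [div_lt_iff₀ (by positivity)] at hα₁
    linarith
  have hα2 : α < 2 := by
    have : 1 / (n : ℝ) ≤ 1 / 2 := one_div_le_one_div_of_le two_pos hnR
    linarith
  -- Chosen so that the coefficient of |F|² in f is n times γ/2, which makes f comparable with n w.
  set γ : ℝ := (n * α - 1) / (n * α) with hγdef
  have hγ : 0 < γ := div_pos (by linarith) (by positivity)
  have hαγ : 1 / α = n * (1 - γ) := by rw [hγdef]; field_simp; ring
  have hcoef : (n * α - 1) / (2 * α) = n * (γ / 2) := by rw [hγdef]; field_simp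
  have hN1 : ∀ p, ‖N p‖ = 1 := fun p => (hN p).1
  have hNt : ∀ p v, inner ℝ
      (fderiv ℝ (F ∘ (extChartAt (𝓡 n) p).symm) (extChartAt (𝓡 n) p p) v) (N p) = 0 := by
    intro p v
    rw [← mfderiv_eq_fderiv_extChartAt hF p]
    exact (hN p).2.1 v
  have hg := metric_posDef hF hFimm
  have hK : ∀ p, GaussShrinker.gaussCurvature F N p =
      (GaussShrinker.secondFundamentalForm F N p).det / (GaussShrinker.metric F p).det := fun p =>
    prod_roots_charpoly hn0 (hg p) (hconv p)
  have hKpos : ∀ p, 0 < GaussShrinker.gaussCurvature F N p ^ α := fun p => by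
    rw [hK]
    exact Real.rpow_pos_of_pos (div_pos (hconv p).det_pos (hg p).det_pos) _
  have hpos : ∀ p, 0 < -inner ℝ (F p) (N p) := fun p => hsol p ▸ hKpos p
  have hle : ∀ p, GaussShrinker.fFun α F N p ≤ n * radiusFun γ F N p := fun p => by
    have := mul_le_mul_of_nonneg_left (sum_inv_roots_charpoly_le hn0 (hg p) (hconv p)) (hKpos p).le
    rw [GaussShrinker.fFun, radiusFun, hcoef, ← hsol p]
    change _ ≤ _ * (n * maxRadius F N p) at this
    change _ * (((GaussShrinker.metric F p)⁻¹ * GaussShrinker.secondFundamentalForm F N p).charpoly.roots.map _).sum - _ ≤ _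
    linarith
  have heq : ∀ p, GaussShrinker.IsUmbilical F N p → GaussShrinker.fFun α F N p = n * radiusFun γ F N p := by
    rintro p ⟨κ, hκ⟩
    have := sum_inv_roots_charpoly_of_eq_smul hn0 (hg p) (hconv p) hκ
    rw [GaussShrinker.fFun, radiusFun, hcoef, ← hsol p, GaussShrinker.principalCurvatures, this, maxRadius]
    ring
  have hmain : ∀ q, (∀ p, radiusFun γ F N p ≤ radiusFun γ F N q) → GaussShrinker.IsUmbilical F N q ∧
      ∀ z, inner ℝ z (N q) = 0 → inner ℝ (F q) z = 0 := fun q hq =>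
    isUmbilical_of_isMax_radiusFun hn hγ hα hα2 hαγ hF hFimm hN1 hNt hconv hpos
      (fun p => by rw [← hK, hsol]) hq
  obtain ⟨q, -, hq⟩ := UpperSemicontinuousOn.exists_isMaxOn ⟨p₀, Set.mem_univ p₀⟩ isCompact_univ
    ((upperSemicontinuous_radiusFun hn0 γ hF hFimm hN1 hNt hconv hpos).upperSemicontinuousOn _)
  have hq' : ∀ p, radiusFun γ F N p ≤ radiusFun γ F N q := fun p => hq (Set.mem_univ p)
  -- The two maxima are tied together: n w(q) = f(q) ≤ f(p₀) ≤ n w(p₀), so p₀ also maximizes w.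
  have hp₀ : radiusFun γ F N q ≤ radiusFun γ F N p₀ := by
    have h1 := heq q (hmain q hq').1
    have h2 := hmax q
    have h3 := hle p₀
    rw [h1] at h2
    exact le_of_mul_le_mul_left (h2.trans h3) (by positivity)
  obtain ⟨h1, h2⟩ := hmain p₀ fun p => (hq' p).trans hp₀
  exact ⟨h1, mfderiv_norm_sq_eq_zero hF fun v => h2 _ (hNt p₀ v)⟩
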